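/- **Setting.** For $a,b,c,d\in\mathbb R^4$ let $\langle abcd\rangle$ be the determinant with rows $a,b,c,d$. The number of sign flips of a real sequence is counted after deleting zeros. Let $n\ge4$ and let $Z_1,\dots,Z_n\in\mathbb R^4$ be positive MHV ($k=0$) data: with the convention $Z_{n+1}:=-Z_1$, $\langle i\,i{+}1\,j\,j{+}1\rangle>0$ for all non-adjacent pairs $1\le i<j\le n$ (so $i+1<j$ and $(i,j)\neq(1,n)$), and $\langle1234\rangle,\langle1235\rangle,\dots,\langle123n\rangle$ has no sign flip. Let $L\ge0$. The $L$-loop MHV amplituhedron is the set of all $((A_\alpha,B_\alpha))_{\alpha=1}^L$, $A_\alpha,B_\alpha\in\mathbb R^4$, such that $\langle A_\alpha B_\alpha\,i\,i{+}1\rangle>0$ for $i=1,\dots,n$, the sequence $\langle A_\alpha B_\alpha12\rangle,\dots,\langle A_\alpha B_\alpha1n\rangle$ has exactly two sign flips, and $\langle A_\alpha B_\alpha A_\beta B_\beta\rangle>0$ for all $\alpha<\beta$. **The ladder cut.** This is the face on which all lines $(AB)_\alpha$ meet the line $(12)$. A generic line meeting $(12)$ passes through $A=Z_1+xZ_2$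 and $B=Z_3+tZ_n-\sigma Z_1$ for unique $x,t,\sigma\in\mathbb R$, so configurations of $L$ such lines have coordinates $(\sigma_\alpha,t_\alpha,x_\alpha)_{\alpha}\in\mathbb R^{3L}$. The ladder region $R\subset\mathbb R^{3L}$ consists of the configurations for which $((A_\alpha,\varepsilon_\alpha B_\alpha))_\alpha$ lies in the closure of the amplituhedron for some signs $\varepsilon_\alpha=\pm1$. It is oriented by $\bigwedge_\alpha \mathrm dx_\alpha\wedge \mathrm d\sigma_\alpha\wedge \mathrm dt_\alpha$. **Canonical forms.** "Generically" means off the zero set of some nonzero polynomial. For a weight $m:\mathbb R^d\to\mathbb Z$ (the indicator function, for a region) a function $\Omega$ on $\mathbb R^d$ is (the coefficient, relative to the oriented volume form, of) a canonical form of $m$ if: for $d=0$, $\Omega=m$; for $d\ge1$, writing points as $(v,u')$ with $v$ the first coordinate, there are finitely many walls $v=r_k(u')$ with $r_k$ rational functions, integer-valued jumps $\delta_k(u')$, a function $m_0(u')$, and functions $\Omega_k(u')$ such that generically $$m(v,u')=m_0(u')+\sum_{k:\,r_k(u')<v}\delta_k(u'),\qquad \Omega(v,u')=\sum_k\frac{\Omega_k(u')}{v-r_k(u')},$$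 and each $\Omega_k$ is a canonical form of the weight $\delta_k$ on $\mathbb R^{d-1}$. That is, $\Omega$ has in $v$ only simple poles, on the boundary, and its residue on each wall is the canonical form of that wall weighted by the jump. On $\mathbb R^{3L}$ the coordinates are taken in the order $\sigma_1,t_1,x_1,\sigma_2,t_2,x_2,\dots$. **The ladder form.** For $j\in\{3,\dots,n-1\}$ put $$K_\alpha(j)=\frac{\langle A_\alpha1\,j\,j{+}1\rangle^2}{\langle(AB)_\alpha1\,j{+}1\rangle^2\,\langle(AB)_\alpha\,j\,j{+}1\rangle},\qquad w_\alpha(j)=-\frac{\langle(AB)_\alpha1\,j\rangle}{\langle(AB)_\alpha1\,j{+}1\rangle},$$ and for a permutation $\pi$ of $\{1,\dots,L\}$ and $1\le s\le e\le L$ $$W[s,e,\pi,j]=\frac{1}{w_{\pi_s}(j)\,\bigl(w_{\pi_{s+1}}(j)-w_{\pi_s}(j)\bigr)\cdots\bigl(w_{\pi_e}(j)-w_{\pi_{e-1}}(j)\bigr)}.$$ **Theorem.** The region $R$ has a canonical form, it is generically unique, and it is $$\Omega^{\rm ladder}=\prod_{\alpha=1}^L \mathrm dx_\alpha\,\langle(AB)_\alpha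 \mathrm d^2B_\alpha\rangle\cdot(-1)^L\sum_{N,J,\pi}\frac{1}{x_{\pi_L}(x_{\pi_{L-1}}-x_{\pi_L})\cdots(x_{\pi_1}-x_{\pi_2})}\prod_{k=1}^{m}\Bigl[\Bigl(\prod_{a=s_k}^{e_k}K_{\pi_a}(j_k)\Bigr)W[s_k,e_k,\pi,j_k]\Bigr],$$ where the sum is over all compositions $N=(N_1,\dots,N_m)$ of $L$ (all $N_k\ge1$), all $J=(j_1,\dots,j_m)$ with $3\le j_1<\dots<j_m\le n-1$, and all permutations $\pi$ of $\{1,\dots,L\}$; $s_k=1+N_1+\dots+N_{k-1}$, $e_k=N_1+\dots+N_k$; and, in the coordinates above, $\langle AB\,\mathrm d^2B\rangle=\langle A\,B\,\partial_\sigma B\,\partial_tB\rangle\,\mathrm d\sigma\wedge\mathrm dt=\langle A\,B\,(-Z_1)\,Z_n\rangle\,\mathrm d\sigma\wedge\mathrm dt$. (For $L=0$ the formula reads $1$.) -/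

import Mathlib

noncomputable section

namespace LadderCut

/-! ### Momentum twistors, brackets, sign flips -/

/-- A vector of `ℝ⁴`, representing a point of projective three-space. -/
abbrev Twistor : Type := Fin 4 → ℝ

/-- The four-bracket `⟨a b c d⟩`. -/
def bracket (a b c d : Twistor) : ℝ := Matrix.det (Matrix.of ![a, b, c, d])

/-- The number of sign flips of a sequence of real numbers (vanishing entries are skipped). -/
def signFlips (l : List ℝ) : ℕ :=
  (((l.map SignType.sign).filter (· ≠ 0)).destutter (· ≠ ·)).length - 1

/-- Positive MHV (`k = 0`) external data `Z 1, …, Z n`: all `⟨i i+1 j j+1⟩` with `i < j` and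
non-adjacent pairs are positive, where the index `n+1` stands for `-Z 1` (the twisted cyclic
convention at `k = 0`), and `⟨1234⟩, ⟨1235⟩, …, ⟨123n⟩` has no sign flip. -/
structure IsMHVData (n : ℕ) (Z : ℕ → Twistor) : Prop where
  pos : ∀ i j, 1 ≤ i → i + 1 < j → j + 1 ≤ n → 0 < bracket (Z i) (Z (i + 1)) (Z j) (Z (j + 1))
  wrap : ∀ i, 2 ≤ i → i + 1 < n → 0 < bracket (Z i) (Z (i + 1)) (Z n) (-Z 1)
  flips : signFlips ((List.range' 4 (n - 3)).map fun i => bracket (Z 1) (Z 2) (Z 3) (Z i)) = 0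

/-- The oriented line through `ℓ.1 = A` and `ℓ.2 = B` lies in the one-loop MHV amplituhedron:
`⟨AB i i+1⟩ > 0` for `i = 1, …, n` (with `n+1` standing for `-Z 1`), and
`⟨AB12⟩, ⟨AB13⟩, …, ⟨AB1n⟩` has two sign flips. -/
structure IsOneLoop (n : ℕ) (Z : ℕ → Twistor) (ℓ : Twistor × Twistor) : Prop where
  pos : ∀ i, 1 ≤ i → i + 1 ≤ n → 0 < bracket ℓ.1 ℓ.2 (Z i) (Z (i + 1))
  wrap : 0 < bracket ℓ.1 ℓ.2 (Z n) (-Z 1)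
  flips : signFlips ((List.range' 2 (n - 1)).map fun i => bracket ℓ.1 ℓ.2 (Z 1) (Z i)) = 2

/-- The `L`-loop MHV amplituhedron: every loop line is in the one-loop amplituhedron, and
the loop lines are mutually positive. -/
def amplituhedron (n : ℕ) (Z : ℕ → Twistor) (L : ℕ) : Set (Fin L → Twistor × Twistor) :=
  {ℓ | (∀ α, IsOneLoop n Z (ℓ α)) ∧
    ∀ α β, α < β → 0 < bracket (ℓ α).1 (ℓ α).2 (ℓ β).1 (ℓ β).2}

/-! ### Coordinates on the cut

A line meeting `(12)` in a point other than `Z 2`, and in general position otherwise, passes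
through `A = Z 1 + x Z 2` and exactly one point `B = Z 3 + t Z n - σ Z 1`.  A configuration of
`L` such lines is a point `u` of `ℝ^(3L)`, the coordinates of loop `α` being
`(u (3α), u (3α+1), u (3α+2)) = (σ, t, x)`. -/

/-- The coordinate `σ` of loop `α`. -/
def sCoord {L : ℕ} (u : Fin (3 * L) → ℝ) (α : Fin L) : ℝ := u ⟨3 * α, by omega⟩

/-- The coordinate `t` of loop `α`. -/
def tCoord {L : ℕ} (u : Fin (3 * L) → ℝ) (α : Fin L) : ℝ := u ⟨3 * α + 1, by omega⟩

/-- The coordinate `x` of loop `α`. -/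
def xCoord {L : ℕ} (u : Fin (3 * L) → ℝ) (α : Fin L) : ℝ := u ⟨3 * α + 2, by omega⟩

/-- The point `A = Z 1 + x Z 2` of the line `(12)`. -/
def pointA (Z : ℕ → Twistor) (x : ℝ) : Twistor := Z 1 + x • Z 2

/-- The second point `B = Z 3 + t Z n - σ Z 1` of a line on the cut. -/
def pointB (n : ℕ) (Z : ℕ → Twistor) (s t : ℝ) : Twistor := Z 3 + t • Z n - s • Z 1

/-- The ladder cut of the amplituhedron, in the coordinates `u`: the configurations of lines
meeting `(12)`, so that `⟨(AB)_α 12⟩ = 0`, that are limits of points of the amplituhedron.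
A line does not determine the orientation of `(A, B)`, whence the signs `ε`. -/
def ladderRegion (n : ℕ) (Z : ℕ → Twistor) (L : ℕ) : Set (Fin (3 * L) → ℝ) :=
  {u | ∃ ε : Fin L → ℝ, (∀ α, ε α = 1 ∨ ε α = -1) ∧
    (fun α => (pointA Z (xCoord u α), ε α • pointB n Z (sCoord u α) (tCoord u α)))
      ∈ closure (amplituhedron n Z L)}

/-! ### Canonical forms -/

/-- `P` holds off the zero set of some nonzero polynomial. -/
def Generic {d : ℕ} (P : (Fin d → ℝ) → Prop) : Prop :=
  ∃ p : MvPolynomial (Fin d) ℝ, p ≠ 0 ∧ ∀ u, MvPolynomial.eval u p ≠ 0 → P u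

/-- `r` is (given, wherever the denominator does not vanish, by) a rational function. -/
def IsRational {d : ℕ} (r : (Fin d → ℝ) → ℝ) : Prop :=
  ∃ p q : MvPolynomial (Fin d) ℝ, q ≠ 0 ∧
    ∀ u, MvPolynomial.eval u q ≠ 0 → r u = MvPolynomial.eval u p / MvPolynomial.eval u q

/-- `IsCanonicalForm d m Ω`: the form with coefficient `Ω` (relative to the standard volume form
of `ℝ^d`, which also fixes the orientation) is the canonical form of the weighted region
`m : ℝ^d → ℤ`; for an honest region `m` is its indicator function.

In dimension `0` the form of a point is its weight.  In dimension `d + 1` split off the first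
coordinate `v = u 0`.  The boundary of the region consists of finitely many walls
`v = r k (u 1, …, u d)` given by rational functions, across which the weight jumps by
`jump k`, together with walls on which `v` is not constrained (these are boundaries of the walls
of the first kind, and are seen at the next step).  The form has, in `v`, no singularities
except a simple pole at each wall `v = r k`, whose residue is the canonical form of that wall
weighted by the jump, and at most a simple pole at `v = ∞`. -/
def IsCanonicalForm : (d : ℕ) → ((Fin d → ℝ) → ℤ) → ((Fin d → ℝ) → ℝ) → Prop
  | 0, m, Ω => ∀ u, Ω u = m u
  | d + 1, m, Ω =>
    ∃ (K : ℕ) (r : Fin K → (Fin d → ℝ) → ℝ) (jump : Fin K → (Fin d → ℝ) → ℤ)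
      (base : (Fin d → ℝ) → ℤ) (res : Fin K → (Fin d → ℝ) → ℝ),
      (∀ k, IsRational (r k)) ∧
      (∀ k, IsCanonicalForm d (jump k) (res k)) ∧
      Generic (fun u : Fin (d + 1) → ℝ => m u = base (Fin.tail u) +
        ∑ k, if r k (Fin.tail u) < u 0 then jump k (Fin.tail u) else 0) ∧
      Generic (fun u : Fin (d + 1) → ℝ => Ω u =
        ∑ k, res k (Fin.tail u) / (u 0 - r k (Fin.tail u)))

/-! ### The ladder form -/

/-- `(c₁ - c₀)(c₂ - c₁)⋯(c_r - c_{r-1})` for the list `c₁, …, c_r`. -/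
def chainDenom : ℝ → List ℝ → ℝ
  | _, [] => 1
  | c₀, c :: l => (c - c₀) * chainDenom c l

/-- `1 / (c₁ (c₂ - c₁) ⋯ (c_r - c_{r-1}))` for the list `c₁, …, c_r`. -/
def chain (l : List ℝ) : ℝ := 1 / chainDenom 0 l

/-- `w = -⟨AB1j⟩ / ⟨AB1j+1⟩`. -/
def wVar (Z : ℕ → Twistor) (A B : Twistor) (j : ℕ) : ℝ :=
  -bracket A B (Z 1) (Z j) / bracket A B (Z 1) (Z (j + 1))

/-- `⟨A1jj+1⟩² / (⟨AB1j+1⟩² ⟨ABjj+1⟩)`, from the measure of the Kermit `[123; 1jj+1]`. -/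
def kermitFactor (Z : ℕ → Twistor) (A B : Twistor) (j : ℕ) : ℝ :=
  bracket A (Z 1) (Z j) (Z (j + 1)) ^ 2 /
    (bracket A B (Z 1) (Z (j + 1)) ^ 2 * bracket A B (Z j) (Z (j + 1)))

/-- The index sets `3 ≤ j_1 < ⋯ < j_m ≤ n - 1`. -/
def indexSets (n m : ℕ) : Finset (Fin m → ℕ) :=
  open Classical in (Fintype.piFinset fun _ : Fin m => Finset.Ico 3 n).filter StrictMono

/-- The coefficient of `∏_α dx_α ⟨(AB)_α d²B_α⟩` in the ladder form, as a function of the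
lines `(A_α, B_α)`, `A_α = Z 1 + x_α Z 2`.  The sum is over compositions `N` of `L`, increasing
index sets `J`, and permutations `π`; the positions `a` of the `k`-th block of `N` are
`N.embedding k a`, i.e. `N_1 + ⋯ + N_{k-1} + 1, …, N_1 + ⋯ + N_k` in order, and
the last factor is the chain `W[s, e, π, j_k]` of that block. -/
def ladderForm (n : ℕ) (Z : ℕ → Twistor) (L : ℕ) (x : Fin L → ℝ) (B : Fin L → Twistor) : ℝ :=
  (-1) ^ L * ∑ N : Composition L, ∑ J ∈ indexSets n N.length, ∑ π : Equiv.Perm (Fin L),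
    chain (List.ofFn fun a => x (π a)).reverse *
      ∏ k : Fin N.length,
        ((∏ a : Fin (N.blocksFun k),
            kermitFactor Z (pointA Z (x (π (N.embedding k a)))) (B (π (N.embedding k a))) (J k)) *
          chain (List.ofFn fun a : Fin (N.blocksFun k) =>
            wVar Z (pointA Z (x (π (N.embedding k a)))) (B (π (N.embedding k a))) (J k)))

/-- The coefficient of the ladder form relative to `⋀_α dx_α ∧ dσ_α ∧ dt_α`: since
`∂B/∂σ = -Z 1` and `∂B/∂t = Z n`, the measure `⟨AB d²B⟩` is `⟨A B (-Z 1) (Z n)⟩ dσ ∧ dt`. -/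
def ladderCoeff (n : ℕ) (Z : ℕ → Twistor) (L : ℕ) (u : Fin (3 * L) → ℝ) : ℝ :=
  ladderForm n Z L (xCoord u) (fun α => pointB n Z (sCoord u α) (tCoord u α)) *
    ∏ α, bracket (pointA Z (xCoord u α)) (pointB n Z (sCoord u α) (tCoord u α)) (-Z 1) (Z n)

end LadderCut

end

noncomputable section

namespace LadderCut

/-! ### Generic properties -/

namespace Generic

variable {d : ℕ} {P Q : (Fin d → ℝ) → Prop}

/-! Canonical forms are additive in the weight and insensitive to generic changes of weight and form
(`IsCanonicalForm.add`, `IsCanonicalForm.congr`). Uniqueness thus reduces to the statement that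
weight zero has form zero (`IsCanonicalForm.eq_zero_of_weight_eq_zero`): two rational walls agree
generically or differ generically, the jumps on coinciding walls cancel, and by induction on the
dimension so do their residues.

For existence the cut is made explicit. On it `⟨AB1i⟩` is `x` times an affine function of `t`,
`⟨ABii+1⟩` is affine in `σ`, and the bracket of two loops factors as `(x_α - x_β)(t_β - t_α)⟨123n⟩`.
Generically the region therefore consists of the configurations with `x, t > 0`, each `σ` above all
its walls, and `x` decreasing as `t` increases (`mem_ladderRegion_imp`, `mem_ladderRegion_of`). The
zeros in `t` of the `⟨AB1j⟩` cut the half-line `t > 0` into intervals, and in the `j`-th one the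
edge `(j, j+1)` alone bounds `σ` (`sWall_le`).

So the region is generically a disjoint union of cells, one for each order `π` of the loops by `t`
and each monotone assignment of interval indices (`indicator_eq_sum_cells`). Such an assignment is
the same as a composition `N`, its fibre sizes, with an increasing `J`, its values
(`exists_composition`, `composition_unique`).

A cell is an iterated fibration: deleting one loop from the ordered list leaves a cell with one loop
fewer, over which the `x` and `t` of that loop range between those of its neighbours or fixed ends,
and `σ` over a ray (`inCell_insert`). The form of a cell is a product over links between neighbours,
and inserting a loop multiplies it by exactly the forms of these intervals and of the ray
(`cellForm_insert`). Finally `w` is a fractional linear coordinate taking the ends of the `j`-th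
interval to `0` and `∞`; it turns the links in `t` into the chains `W`, while the Kermit factor and
the measure supply the Jacobian and the pole in `σ` (`kermitFactor_mul`). Cells and terms of the
ladder form then match one to one. -/

theorem of_forall (h : ∀ u, P u) : Generic P := ⟨1, one_ne_zero, fun u _ => h u⟩

theorem mono (hP : Generic P) (h : ∀ u, P u → Q u) : Generic Q := by
  obtain ⟨p, hp, H⟩ := hP
  exact ⟨p, hp, fun u hu => h u (H u hu)⟩

theorem and (hP : Generic P) (hQ : Generic Q) : Generic fun u => P u ∧ Q u := by
  obtain ⟨p, hp, H⟩ := hP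
  obtain ⟨q, hq, H'⟩ := hQ
  refine ⟨p * q, mul_ne_zero hp hq, fun u hu => ?_⟩
  rw [map_mul] at hu
  exact ⟨H u (left_ne_zero_of_mul hu), H' u (right_ne_zero_of_mul hu)⟩

theorem mono₂ {R : (Fin d → ℝ) → Prop} (hP : Generic P) (hQ : Generic Q)
    (h : ∀ u, P u → Q u → R u) : Generic R :=
  (hP.and hQ).mono fun u hu => h u hu.1 hu.2

theorem finset_forall {ι : Type*} (s : Finset ι) {P : ι → (Fin d → ℝ) → Prop}
    (h : ∀ i ∈ s, Generic (P i)) : Generic fun u => ∀ i ∈ s, P i u := by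
  classical
  induction s using Finset.induction_on with
  | empty => exact of_forall fun u i hi => absurd hi (Finset.notMem_empty i)
  | insert a s _ ih =>
    refine (h a (Finset.mem_insert_self a s)).mono₂
      (ih fun i hi => h i (Finset.mem_insert_of_mem hi)) fun u h1 h2 i hi => ?_
    rcases Finset.mem_insert.1 hi with rfl | hi
    exacts [h1, h2 i hi]

theorem fintype_forall {ι : Type*} [Fintype ι] {P : ι → (Fin d → ℝ) → Prop}
    (h : ∀ i, Generic (P i)) : Generic fun u => ∀ i, P i u :=
  (finset_forall Finset.univ fun i _ => h i).mono fun _ hu i => hu i (Finset.mem_univ i)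

theorem exists_point (hP : Generic P) : ∃ u, P u := by
  obtain ⟨p, hp, H⟩ := hP
  obtain ⟨u, hu⟩ : ∃ u, MvPolynomial.eval u p ≠ 0 := by
    by_contra! h
    exact hp (MvPolynomial.funext fun u => by simpa using h u)
  exact ⟨u, H u hu⟩

theorem tail (hP : Generic P) : Generic fun u : Fin (d + 1) → ℝ => P (Fin.tail u) := by
  obtain ⟨p, hp, H⟩ := hP
  refine ⟨MvPolynomial.rename Fin.succ p, fun h => hp ?_, fun u hu => H _ ?_⟩
  · exact MvPolynomial.rename_injective _ (Fin.succ_injective d) (by simpa using h)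
  · rwa [MvPolynomial.eval_rename] at hu

/-- For a generic choice of the other coordinates, a generic property holds for all but finitely
many values of the first coordinate. -/
theorem slice {P : (Fin (d + 1) → ℝ) → Prop} (hP : Generic P) :
    Generic fun u : Fin d → ℝ => {v : ℝ | ¬ P (Fin.cons v u)}.Finite := by
  obtain ⟨p, hp, H⟩ := hP
  set f := MvPolynomial.finSuccEquiv ℝ d p with hf
  have hf0 : f ≠ 0 := by simpa [hf] using hp
  -- Where the leading coefficient in the first variable does not vanish, the restriction to the
  -- fibre is a nonzero polynomial in one variable and has finitely many roots.
  refine ⟨f.leadingCoeff, Polynomial.leadingCoeff_ne_zero.2 hf0, fun u hu => ?_⟩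
  have hmap : f.map (MvPolynomial.eval u) ≠ 0 := by
    intro h0
    apply hu
    have := congrArg (fun g => Polynomial.coeff g f.natDegree) h0
    simpa [Polynomial.coeff_map] using this
  refine (Polynomial.finite_setOfPred_isRoot hmap).subset fun v hv => ?_
  by_contra hroot
  apply hv
  apply H
  rw [MvPolynomial.eval_eq_eval_mv_eval']
  exact hroot

end Generic

/-- A nonzero polynomial in no variables vanishes nowhere. This makes the pointwise condition in
dimension `0` compatible with generic statements in higher dimension. -/
theorem generic_zero {P : (Fin 0 → ℝ) → Prop} (hP : Generic P) (u) : P u := by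
  obtain ⟨v, hv⟩ := hP.exists_point
  rwa [Subsingleton.elim u v]

/-- `f` is a polynomial function. -/
def IsPoly {d : ℕ} (f : (Fin d → ℝ) → ℝ) : Prop :=
  ∃ p : MvPolynomial (Fin d) ℝ, ∀ u, MvPolynomial.eval u p = f u

/-! ### Polynomial and rational functions -/

namespace IsPoly

variable {d : ℕ} {f g : (Fin d → ℝ) → ℝ}

theorem const (c : ℝ) : IsPoly fun _ : Fin d → ℝ => c := ⟨MvPolynomial.C c, by simp⟩

theorem coord (i : Fin d) : IsPoly fun u : Fin d → ℝ => u i := ⟨MvPolynomial.X i, by simp⟩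

theorem add (hf : IsPoly f) (hg : IsPoly g) : IsPoly fun u => f u + g u := by
  obtain ⟨p, hp⟩ := hf
  obtain ⟨q, hq⟩ := hg
  exact ⟨p + q, fun u => by simp [hp, hq]⟩

theorem mul (hf : IsPoly f) (hg : IsPoly g) : IsPoly fun u => f u * g u := by
  obtain ⟨p, hp⟩ := hf
  obtain ⟨q, hq⟩ := hg
  exact ⟨p * q, fun u => by simp [hp, hq]⟩

theorem neg (hf : IsPoly f) : IsPoly fun u => -f u := by
  obtain ⟨p, hp⟩ := hf
  exact ⟨-p, fun u => by simp [hp]⟩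

theorem sub (hf : IsPoly f) (hg : IsPoly g) : IsPoly fun u => f u - g u := by
  simpa [sub_eq_add_neg] using hf.add hg.neg

theorem tail (hf : IsPoly f) : IsPoly fun u : Fin (d + 1) → ℝ => f (Fin.tail u) := by
  obtain ⟨p, hp⟩ := hf
  exact ⟨MvPolynomial.rename Fin.succ p, fun u => by rw [MvPolynomial.eval_rename]; exact hp _⟩

theorem generic_ne (hf : IsPoly f) (h : ∃ u, f u ≠ 0) : Generic fun u => f u ≠ 0 := by
  obtain ⟨p, hp⟩ := hf
  obtain ⟨u, hu⟩ := h
  refine ⟨p, fun h0 => hu ?_, fun u hu => by beta_reduce; rwa [← hp]⟩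
  rw [← hp, h0, map_zero]

theorem isRational_div (hf : IsPoly f) (hg : IsPoly g) (h : ∃ u, g u ≠ 0) :
    IsRational fun u => f u / g u := by
  obtain ⟨p, hp⟩ := hf
  obtain ⟨q, hq⟩ := hg
  obtain ⟨u, hu⟩ := h
  refine ⟨p, q, fun h0 => hu ?_, fun u _ => by rw [hp, hq]⟩
  rw [← hq, h0, map_zero]

theorem isRational (hf : IsPoly f) : IsRational f := by
  simpa using hf.isRational_div (const 1) ⟨0, one_ne_zero⟩

end IsPoly

namespace IsRational

variable {d : ℕ} {r s : (Fin d → ℝ) → ℝ}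

theorem tail (hr : IsRational r) : IsRational fun u : Fin (d + 1) → ℝ => r (Fin.tail u) := by
  obtain ⟨p, q, hq, h⟩ := hr
  refine ⟨MvPolynomial.rename Fin.succ p, MvPolynomial.rename Fin.succ q, fun h0 => hq ?_,
    fun u hu => ?_⟩
  · exact MvPolynomial.rename_injective _ (Fin.succ_injective d) (by simpa using h0)
  · rw [MvPolynomial.eval_rename] at hu ⊢
    rw [MvPolynomial.eval_rename]
    exact h _ hu

/-- The cross-multiplied difference is a polynomial: either it is zero or its nonvanishing is a
generic condition. With this dichotomy coinciding walls can be grouped once and for all,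
independently of the point. -/
theorem generic_eq_or_ne (hr : IsRational r) (hs : IsRational s) :
    (Generic fun u => r u = s u) ∨ Generic fun u => r u ≠ s u := by
  obtain ⟨p, q, hq, h⟩ := hr
  obtain ⟨p', q', hq', h'⟩ := hs
  by_cases h0 : p * q' - p' * q = 0
  · left
    refine ⟨q * q', mul_ne_zero hq hq', fun u hu => ?_⟩
    rw [map_mul] at hu
    have h1 := left_ne_zero_of_mul hu
    have h2 := right_ne_zero_of_mul hu
    rw [h u h1, h' u h2, div_eq_div_iff h1 h2]
    have := congrArg (MvPolynomial.eval u) h0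
    simp only [map_sub, map_mul, map_zero] at this
    linarith
  · right
    refine ⟨(p * q' - p' * q) * (q * q'), mul_ne_zero h0 (mul_ne_zero hq hq'), fun u hu => ?_⟩
    simp only [map_mul, map_sub] at hu
    have h1 := left_ne_zero_of_mul (right_ne_zero_of_mul hu)
    have h2 := right_ne_zero_of_mul (right_ne_zero_of_mul hu)
    rw [h u h1, h' u h2, Ne, div_eq_div_iff h1 h2]
    exact fun h3 => left_ne_zero_of_mul hu (by rw [h3, sub_self])

theorem generic_ne_coord (hr : IsRational r) :
    Generic fun u : Fin (d + 1) → ℝ => u 0 ≠ r (Fin.tail u) := by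
  rcases (IsPoly.coord (d := d + 1) 0).isRational.generic_eq_or_ne hr.tail with h | h
  · obtain ⟨u, hu⟩ := h.slice.exists_point
    -- If the coordinate agreed generically with `r`, then on some fibre all but finitely many `v`
    -- would equal the single number `r u`, and the real line would be finite.
    have h1 : ({v : ℝ | ¬ v = r u} ∪ {r u}).Finite := by
      refine Set.Finite.union ?_ (Set.finite_singleton _)
      simpa [Fin.cons_zero, Fin.tail_cons] using hu
    have h2 : ({v : ℝ | ¬ v = r u} ∪ {r u}) = Set.univ := by
      ext v
      by_cases hv : v = r u <;> simp [hv]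
    exact absurd (h2 ▸ h1) Set.infinite_univ.not_finite
  · exact h

end IsRational

/-! ### Weighted canonical forms -/

namespace IsCanonicalForm

theorem congr : ∀ {d : ℕ} {m m' : (Fin d → ℝ) → ℤ} {Ω Ω' : (Fin d → ℝ) → ℝ},
    IsCanonicalForm d m Ω → (Generic fun u => m' u = m u) → (Generic fun u => Ω' u = Ω u) →
    IsCanonicalForm d m' Ω'
  | 0, m, m', Ω, Ω', h, hm, hΩ => fun u => by
    rw [generic_zero hΩ u, generic_zero hm u]; exact h u
  | d + 1, m, m', Ω, Ω', ⟨K, r, jump, base, res, h1, h2, h3, h4⟩, hm, hΩ =>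
    ⟨K, r, jump, base, res, h1, h2, hm.mono₂ h3 fun u a b => a.trans b,
      hΩ.mono₂ h4 fun u a b => a.trans b⟩

theorem zero : ∀ d : ℕ, IsCanonicalForm d (fun _ => 0) (fun _ => 0)
  | 0 => fun u => by simp
  | d + 1 => ⟨0, Fin.elim0, Fin.elim0, fun _ => 0, Fin.elim0, fun k => k.elim0, fun k => k.elim0,
      Generic.of_forall fun u => by simp, Generic.of_forall fun u => by simp⟩

theorem neg : ∀ {d : ℕ} {m : (Fin d → ℝ) → ℤ} {Ω : (Fin d → ℝ) → ℝ},
    IsCanonicalForm d m Ω → IsCanonicalForm d (fun u => -m u) (fun u => -Ω u)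
  | 0, m, Ω, h => fun u => by beta_reduce; rw [h u]; push_cast; rfl
  | d + 1, m, Ω, ⟨K, r, jump, base, res, h1, h2, h3, h4⟩ =>
    ⟨K, r, fun k u => -jump k u, fun u => -base u, fun k u => -res k u, h1,
      fun k => (h2 k).neg,
      h3.mono fun u hu => by
        beta_reduce
        rw [hu, neg_add, ← Finset.sum_neg_distrib]
        congr 1
        refine Finset.sum_congr rfl fun k _ => ?_
        split_ifs <;> simp,
      h4.mono fun u hu => by
        beta_reduce
        rw [hu, ← Finset.sum_neg_distrib]
        exact Finset.sum_congr rfl fun k _ => by ring⟩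

/-- The lists of walls are concatenated. Nothing requires the walls in a presentation to be
distinct, so no merging is needed. -/
theorem add : ∀ {d : ℕ} {m m' : (Fin d → ℝ) → ℤ} {Ω Ω' : (Fin d → ℝ) → ℝ},
    IsCanonicalForm d m Ω → IsCanonicalForm d m' Ω' →
    IsCanonicalForm d (fun u => m u + m' u) (fun u => Ω u + Ω' u)
  | 0, m, m', Ω, Ω', h, h' => fun u => by beta_reduce; rw [h u, h' u]; push_cast; rfl
  | d + 1, m, m', Ω, Ω', ⟨K, r, jump, base, res, h1, h2, h3, h4⟩,
      ⟨K', r', jump', base', res', h1', h2', h3', h4'⟩ =>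
    ⟨K + K', Fin.append r r', Fin.append jump jump', fun u => base u + base' u,
      Fin.append res res',
      fun k => by
        refine Fin.addCases (fun i => ?_) (fun i => ?_) k
        · simpa using h1 i
        · simpa using h1' i,
      fun k => by
        refine Fin.addCases (fun i => ?_) (fun i => ?_) k
        · simpa using h2 i
        · simpa using h2' i,
      h3.mono₂ h3' fun u a b => by
        beta_reduce
        rw [a, b, Fin.sum_univ_add]
        simp only [Fin.append_left, Fin.append_right]
        ring,
      h4.mono₂ h4' fun u a b => by
        beta_reduce
        rw [a, b, Fin.sum_univ_add]
        simp only [Fin.append_left, Fin.append_right]⟩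

theorem sum {d : ℕ} {ι : Type*} (s : Finset ι) {m : ι → (Fin d → ℝ) → ℤ}
    {Ω : ι → (Fin d → ℝ) → ℝ} (h : ∀ i ∈ s, IsCanonicalForm d (m i) (Ω i)) :
    IsCanonicalForm d (fun u => ∑ i ∈ s, m i u) (fun u => ∑ i ∈ s, Ω i u) := by
  classical
  induction s using Finset.induction_on with
  | empty => simpa using zero d
  | insert a s ha ih =>
    simp only [Finset.sum_insert ha]
    exact (h a (Finset.mem_insert_self a s)).add
      (ih fun i hi => h i (Finset.mem_insert_of_mem hi))

/-- The canonical form of the part of a cylinder above a wall. -/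
theorem ray {d : ℕ} {m : (Fin d → ℝ) → ℤ} {Ω : (Fin d → ℝ) → ℝ} (h : IsCanonicalForm d m Ω)
    {r : (Fin d → ℝ) → ℝ} (hr : IsRational r) :
    IsCanonicalForm (d + 1) (fun u => if r (Fin.tail u) < u 0 then m (Fin.tail u) else 0)
      (fun u => Ω (Fin.tail u) / (u 0 - r (Fin.tail u))) :=
  ⟨1, fun _ => r, fun _ => m, fun _ => 0, fun _ => Ω, fun _ => hr, fun _ => h,
    Generic.of_forall fun u => by simp, Generic.of_forall fun u => by simp⟩

/-- The canonical form of the part of a cylinder between two walls; the upper one is optional. -/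
theorem interval {d : ℕ} {m : (Fin d → ℝ) → ℤ} {Ω : (Fin d → ℝ) → ℝ} (h : IsCanonicalForm d m Ω)
    {lo : (Fin d → ℝ) → ℝ} (hlo : IsRational lo) (hi : Option ((Fin d → ℝ) → ℝ))
    (hhi : ∀ r ∈ hi, IsRational r) (hlt : ∀ r ∈ hi, ∀ u, m u ≠ 0 → lo u < r u) :
    IsCanonicalForm (d + 1)
      (fun u => if lo (Fin.tail u) < u 0 ∧ ∀ r ∈ hi, u 0 < r (Fin.tail u)
        then m (Fin.tail u) else 0)
      (fun u => Ω (Fin.tail u) * (1 / (u 0 - lo (Fin.tail u)) -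
        hi.elim 0 fun r => 1 / (u 0 - r (Fin.tail u)))) := by
  cases hi with
  | none =>
    refine (h.ray hlo).congr (Generic.of_forall fun u => by simp)
      (Generic.of_forall fun u => by simp [div_eq_mul_inv])
  | some r =>
    have hr := hhi r rfl
    -- An interval is the ray above its lower end minus the ray above its upper end. The ends need
    -- to be in order only where the weight is nonzero; the locus `v = r` is generically avoided.
    refine ((h.ray hlo).add (h.ray hr).neg).congr (hr.generic_ne_coord.mono fun u hu => ?_)
      (Generic.of_forall fun u => by simp only [Option.elim]; ring)
    by_cases hm : m (Fin.tail u) = 0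
    · simp [hm]
    · have := hlt r rfl _ hm
      rcases lt_or_gt_of_ne hu with h1 | h1
      · simp [h1, h1.not_gt]
      · simp [h1, h1.not_gt, this.trans h1]

/-- The jumps of a vanishing weight cancel wall by wall. -/
theorem sum_jump_eq_zero {K : ℕ} (r : Fin K → ℝ) (jump : Fin K → ℤ) (base : ℤ)
    (h : {v : ℝ | ¬ (0 = base + ∑ k, if r k < v then jump k else 0)}.Finite) (c : ℝ) :
    ∑ k with r k = c, jump k = 0 := by
  have hfin : ({v : ℝ | ¬ (0 = base + ∑ k, if r k < v then jump k else 0)} ∪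
      Set.range r).Finite := h.union (Set.finite_range r)
  obtain ⟨a, hac, ha⟩ : ∃ a < c, ∀ v ∈ Set.Ioo a c,
      v ∉ ({v : ℝ | ¬ (0 = base + ∑ k, if r k < v then jump k else 0)} ∪ Set.range r) := by
    have : ∀ᶠ v in nhdsWithin c (Set.Iio c), v ∉ ({v : ℝ | ¬ (0 = base +
        ∑ k, if r k < v then jump k else 0)} ∪ Set.range r) := by
      have h1 := (hfin.sdiff (t := {c})).isClosed.isOpen_compl.mem_nhds
        (x := c) (by simp)
      filter_upwards [nhdsWithin_le_nhds h1, self_mem_nhdsWithin] with v hv hvc hv'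
      exact hv ⟨hv', ne_of_lt hvc⟩
    obtain ⟨a, ha, hs⟩ := mem_nhdsLT_iff_exists_Ioo_subset.1 this
    exact ⟨a, ha, fun v hv => hs hv⟩
  obtain ⟨b, hcb, hb⟩ : ∃ b > c, ∀ v ∈ Set.Ioo c b,
      v ∉ ({v : ℝ | ¬ (0 = base + ∑ k, if r k < v then jump k else 0)} ∪ Set.range r) := by
    have : ∀ᶠ v in nhdsWithin c (Set.Ioi c), v ∉ ({v : ℝ | ¬ (0 = base +
        ∑ k, if r k < v then jump k else 0)} ∪ Set.range r) := by
      have h1 := (hfin.sdiff (t := {c})).isClosed.isOpen_compl.mem_nhds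
        (x := c) (by simp)
      filter_upwards [nhdsWithin_le_nhds h1, self_mem_nhdsWithin] with v hv hvc hv'
      exact hv ⟨hv', ne_of_gt hvc⟩
    obtain ⟨b, hb, hs⟩ := mem_nhdsGT_iff_exists_Ioo_subset.1 this
    exact ⟨b, hb, fun v hv => hs hv⟩
  have h1 := ha ((a + c) / 2) ⟨by linarith, by linarith⟩
  have h2 := hb ((c + b) / 2) ⟨by linarith, by linarith⟩
  simp only [Set.mem_union, not_or, Set.mem_ofPred_eq, not_not] at h1 h2
  -- The two midpoints are regular values on either side of `c` with no other wall location between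
  -- them, so the two step sums differ exactly by the jumps at `c`.
  have h3 : ∑ k with r k = c, jump k = (∑ k, if r k < (c + b) / 2 then jump k else 0) -
      ∑ k, if r k < (a + c) / 2 then jump k else 0 := by
    rw [Finset.sum_filter, ← Finset.sum_sub_distrib]
    refine Finset.sum_congr rfl fun k _ => ?_
    rcases lt_trichotomy (r k) c with hk | hk | hk
    · have : r k < (a + c) / 2 := by
        by_contra! h4
        refine (ha (r k) ⟨by linarith, hk⟩) (Or.inr ⟨k, rfl⟩)
      rw [if_neg hk.ne, if_pos this, if_pos (by linarith), sub_self]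
    · rw [if_pos hk, if_pos (by linarith), if_neg (by linarith), sub_zero]
    · have : ¬ r k < (c + b) / 2 := by
        intro h4
        refine (hb (r k) ⟨hk, by linarith⟩) (Or.inr ⟨k, rfl⟩)
      rw [if_neg hk.ne', if_neg this, if_neg (by linarith), sub_self]
  rw [h3]
  linarith [h1.1, h2.1]

/-- Induction on the dimension. Walls are grouped by generic coincidence; on each group the jumps
sum to zero, hence by induction the residues do as well, and the terms of the group share one
denominator. -/
theorem eq_zero_of_weight_eq_zero : ∀ {d : ℕ} {m : (Fin d → ℝ) → ℤ} {Ω : (Fin d → ℝ) → ℝ},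
    IsCanonicalForm d m Ω → (Generic fun u => m u = 0) → Generic fun u => Ω u = 0
  | 0, m, Ω, h, hm => hm.mono fun u hu => by rw [h u, hu, Int.cast_zero]
  | d + 1, m, Ω, ⟨K, r, jump, base, res, h1, h2, h3, h4⟩, hm => by
    classical
    have hcases := fun k l => (h1 k).generic_eq_or_ne (h1 l)
    -- At a generic point the walls meet only if they coincide generically, so the grouping by
    -- values at the point is the fixed grouping.
    have hsep : Generic fun u : Fin d → ℝ =>
        ∀ k l, r l u = r k u ↔ Generic fun u => r l u = r k u := by
      refine Generic.fintype_forall fun k => Generic.fintype_forall fun l => ?_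
      by_cases hkl : Generic fun u => r l u = r k u
      · exact hkl.mono fun u hu => iff_of_true hu hkl
      · exact ((hcases l k).resolve_left hkl).mono fun u hu => iff_of_false hu hkl
    have hslice := (hm.mono₂ h3 fun u a b => a.symm.trans b).slice
    simp only [Fin.tail_cons, Fin.cons_zero] at hslice
    have hjump : ∀ k, Generic fun u : Fin d → ℝ =>
        ∑ l with Generic fun u => r l u = r k u, jump l u = 0 := fun k =>
      hslice.mono₂ hsep fun u hu hs => by
        rw [← sum_jump_eq_zero (fun l => r l u) (fun l => jump l u) (base u) hu (r k u)]
        exact Finset.sum_congr (Finset.filter_congr fun l _ => (hs k l).symm) fun _ _ => rfl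
    have hres : Generic fun u : Fin d → ℝ => ∀ k,
        ∑ l with Generic fun u => r l u = r k u, res l u = 0 :=
      Generic.fintype_forall fun k =>
        eq_zero_of_weight_eq_zero (sum _ fun l _ => h2 l) (hjump k)
    refine h4.mono₂ (hres.mono₂ hsep fun u a b => And.intro a b).tail fun u hu hr => ?_
    obtain ⟨hr1, hr2⟩ := hr
    rw [hu, ← Finset.sum_fiberwise_of_maps_to (g := fun k => r k (Fin.tail u))
      (t := Finset.univ.image fun k => r k (Fin.tail u))
      fun k _ => Finset.mem_image_of_mem _ (Finset.mem_univ k)]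
    refine Finset.sum_eq_zero fun c hc => ?_
    obtain ⟨k, -, rfl⟩ := Finset.mem_image.1 hc
    have : ∀ l ∈ Finset.univ.filter (fun l => r l (Fin.tail u) = r k (Fin.tail u)),
        res l (Fin.tail u) / (u 0 - r l (Fin.tail u)) =
          res l (Fin.tail u) / (u 0 - r k (Fin.tail u)) := fun l hl => by
      rw [(Finset.mem_filter.1 hl).2]
    rw [Finset.sum_congr rfl this, ← Finset.sum_div]
    rw [Finset.filter_congr fun l _ => hr2 k l, hr1 k, zero_div]

theorem generic_unique {d : ℕ} {m : (Fin d → ℝ) → ℤ} {Ω Ω' : (Fin d → ℝ) → ℝ}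
    (h : IsCanonicalForm d m Ω) (h' : IsCanonicalForm d m Ω') : Generic fun u => Ω u = Ω' u :=
  ((h.add h'.neg).eq_zero_of_weight_eq_zero (Generic.of_forall fun u => add_neg_cancel _)).mono
    fun u hu => by linarith

end IsCanonicalForm

/-! ### Brackets -/

theorem bracket_eq (a b c d : Twistor) : bracket a b c d =
     a 0 * b 1 * c 2 * d 3 - a 0 * b 1 * c 3 * d 2 - a 0 * b 2 * c 1 * d 3 + a 0 * b 2 * c 3 * d 1
      + a 0 * b 3 * c 1 * d 2 - a 0 * b 3 * c 2 * d 1 - a 1 * b 0 * c 2 * d 3 + a 1 * b 0 * c 3 * d 2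
      + a 1 * b 2 * c 0 * d 3 - a 1 * b 2 * c 3 * d 0 - a 1 * b 3 * c 0 * d 2 + a 1 * b 3 * c 2 * d 0
      + a 2 * b 0 * c 1 * d 3 - a 2 * b 0 * c 3 * d 1 - a 2 * b 1 * c 0 * d 3 + a 2 * b 1 * c 3 * d 0
      + a 2 * b 3 * c 0 * d 1 - a 2 * b 3 * c 1 * d 0 - a 3 * b 0 * c 1 * d 2 + a 3 * b 0 * c 2 * d 1
      + a 3 * b 1 * c 0 * d 2 - a 3 * b 1 * c 2 * d 0 - a 3 * b 2 * c 0 * d 1 + a 3 * b 2 * c 1 * d 0 := by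
  simp [bracket, Matrix.det_succ_row_zero, Fin.sum_univ_succ, Fin.succAbove]
  ring

theorem bracket_swap_middle (a b c d : Twistor) : bracket a c b d = -bracket a b c d := by
  rw [bracket_eq, bracket_eq]; ring

theorem bracket_swap_right (a b c d : Twistor) : bracket a b d c = -bracket a b c d := by
  rw [bracket_eq, bracket_eq]; ring

theorem bracket_swap_pairs (a b c d : Twistor) : bracket c d a b = bracket a b c d := by
  rw [bracket_eq, bracket_eq]; ring

theorem bracket_rotate_right (a b c d : Twistor) : bracket a c d b = bracket a b c d := by
  rw [bracket_eq, bracket_eq]; ring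

theorem bracket_rotate (a b c d : Twistor) : bracket b c d a = -bracket a b c d := by
  rw [bracket_eq, bracket_eq]; ring

theorem bracket_self (a b c : Twistor) : bracket a b c c = 0 := by
  rw [bracket_eq]; ring

theorem bracket_neg_right (a b c d : Twistor) : bracket a b c (-d) = -bracket a b c d := by
  simp only [bracket_eq, Pi.neg_apply]; ring

theorem bracket_neg_third (a b c d : Twistor) : bracket a b (-c) d = -bracket a b c d := by
  simp only [bracket_eq, Pi.neg_apply]; ring

theorem bracket_smul_second (k : ℝ) (a b c d : Twistor) :
    bracket a (k • b) c d = k * bracket a b c d := by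
  simp only [bracket_eq, Pi.smul_apply, smul_eq_mul]; ring

theorem bracket_smul_right (k : ℝ) (a b c d : Twistor) :
    bracket a b c (k • d) = k * bracket a b c d := by
  simp only [bracket_eq, Pi.smul_apply, smul_eq_mul]; ring

/-- The three-term Plücker relation of two-brackets, after projection through `a` and `b`. -/
theorem bracket_pluecker (a b c d e f : Twistor) :
    bracket a b c d * bracket a b e f - bracket a b c e * bracket a b d f +
      bracket a b c f * bracket a b d e = 0 := by
  simp only [bracket_eq]; ring

theorem continuous_bracket {X : Type*} [TopologicalSpace X] {a b c d : X → Twistor}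
    (ha : Continuous a) (hb : Continuous b) (hc : Continuous c) (hd : Continuous d) :
    Continuous fun x => bracket (a x) (b x) (c x) (d x) := by
  simp only [bracket_eq]
  fun_prop

/-! ### Sign flips -/

theorem destutter'_append_of_eq {α : Type*} [DecidableEq α] (a : α) (l l' : List α)
    (h : ∀ x ∈ l, x = a) :
    (l ++ l').destutter' (· ≠ ·) a = l'.destutter' (· ≠ ·) a := by
  induction l with
  | nil => rfl
  | cons b l ih =>
    rw [List.cons_append, List.destutter'_cons_neg _ (by simp [h b List.mem_cons_self])]
    exact ih fun x hx => h x (List.mem_cons_of_mem _ hx)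

theorem map_sign_filter_of_pos (l : List ℝ) (h : ∀ x ∈ l, 0 < x) :
    ((l.map SignType.sign).filter (· ≠ 0)) = List.replicate l.length 1 := by
  induction l with
  | nil => rfl
  | cons b l ih =>
    have hb : SignType.sign b = 1 := sign_pos (h b List.mem_cons_self)
    rw [List.map_cons, hb, List.filter_cons_of_pos (by simp),
      ih fun x hx => h x (List.mem_cons_of_mem _ hx)]
    rfl

theorem map_sign_filter_of_neg (l : List ℝ) (h : ∀ x ∈ l, x < 0) :
    ((l.map SignType.sign).filter (· ≠ 0)) = List.replicate l.length (-1) := by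
  induction l with
  | nil => rfl
  | cons b l ih =>
    have hb : SignType.sign b = -1 := sign_neg (h b List.mem_cons_self)
    rw [List.map_cons, hb, List.filter_cons_of_pos (by simp),
      ih fun x hx => h x (List.mem_cons_of_mem _ hx)]
    rfl

theorem signFlips_eq_zero_of_pos (l : List ℝ) (h : ∀ x ∈ l, 0 < x) : signFlips l = 0 := by
  rw [signFlips, map_sign_filter_of_pos l h]
  cases l with
  | nil => rfl
  | cons a l =>
    rw [List.length_cons, List.replicate_succ, List.destutter_cons',
      ← List.append_nil (List.replicate l.length (1 : SignType)),
      destutter'_append_of_eq _ _ _ fun x hx => List.eq_of_mem_replicate hx]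
    rfl

/-- Zeros are skipped in counting flips, so the absence of flips gives only weak inequalities. -/
theorem nonneg_of_signFlips_eq_zero (a : ℝ) (l : List ℝ) (ha : 0 < a)
    (h : signFlips (a :: l) = 0) : ∀ x ∈ l, 0 ≤ x := by
  rw [signFlips, List.map_cons, sign_pos ha, List.filter_cons_of_pos (by simp),
    List.destutter_cons'] at h
  have key : ∀ m : List SignType, (m.destutter' (· ≠ ·) 1).length - 1 = 0 → ∀ x ∈ m, x = 1 := by
    intro m
    induction m with
    | nil => simp
    | cons b m ih =>
      intro hm
      by_cases hb : (1 : SignType) = b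
      · subst hb
        rw [List.destutter'_cons_neg _ (by simp)] at hm
        intro x hx
        rcases List.mem_cons.1 hx with rfl | hx
        exacts [rfl, ih hm x hx]
      · rw [List.destutter'_cons_pos _ hb, List.length_cons, Nat.add_sub_cancel,
          List.length_eq_zero_iff] at hm
        exact absurd hm (List.destutter'_ne_nil _ _)
  intro x hx
  by_contra! hneg
  have := key _ h (-1) (List.mem_filter.2 ⟨List.mem_map.2 ⟨x, hx, sign_neg hneg⟩, by simp⟩)
  exact absurd this (by decide)

theorem signFlips_pos_neg_pos (a b c : ℝ) (l l' : List ℝ) (ha : 0 < a) (hb : b < 0)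
    (hl : ∀ x ∈ l, x < 0) (hc : 0 < c) (hl' : ∀ x ∈ l', 0 < x) :
    signFlips (a :: (b :: l ++ c :: l')) = 2 := by
  rw [signFlips, List.map_cons, List.map_append, sign_pos ha, List.filter_cons_of_pos (by simp),
    List.destutter_cons', List.filter_append, List.map_cons, List.map_cons, sign_neg hb,
    sign_pos hc, List.filter_cons_of_pos (by simp), List.filter_cons_of_pos (by simp),
    map_sign_filter_of_pos _ hl', map_sign_filter_of_neg _ hl, List.cons_append,
    List.destutter'_cons_pos _ (by decide),
    destutter'_append_of_eq _ _ _ fun x hx => List.eq_of_mem_replicate hx,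
    List.destutter'_cons_pos _ (by decide),
    ← List.append_nil (List.replicate l'.length (1 : SignType)),
    destutter'_append_of_eq _ _ _ fun x hx => List.eq_of_mem_replicate hx]
  rfl

theorem signFlips_range' (f : ℕ → ℝ) {n p : ℕ} (h3 : 3 ≤ p) (hpn : p < n) (h2 : 0 < f 2)
    (hneg : ∀ i, 3 ≤ i → i ≤ p → f i < 0) (hpos : ∀ i, p < i → i ≤ n → 0 < f i) :
    signFlips ((List.range' 2 (n - 1)).map f) = 2 := by
  have e : List.range' 2 (n - 1) =
      2 :: (3 :: List.range' 4 (p - 3) ++ (p + 1) :: List.range' (p + 2) (n - p - 1)) := by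
    have e1 : n - 1 = 1 + ((p - 3 + 1) + (n - p - 1 + 1)) := by omega
    rw [e1, ← List.range'_append_1, ← List.range'_append_1 (m := p - 3 + 1), List.range'_succ,
      List.range'_succ (s := 2 + 1), List.range'_succ, show 2 + 1 + (p - 3 + 1) = p + 1 by omega]
    rfl
  rw [e, List.map_cons, List.map_append, List.map_cons, List.map_cons]
  refine signFlips_pos_neg_pos _ _ _ _ _ h2 (hneg 3 le_rfl h3) ?_ (hpos _ (by omega) (by omega)) ?_
  · intro x hx
    obtain ⟨i, hi, rfl⟩ := List.mem_map.1 hx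
    rw [List.mem_range'_1] at hi
    exact hneg i (by omega) (by omega)
  · intro x hx
    obtain ⟨i, hi, rfl⟩ := List.mem_map.1 hx
    rw [List.mem_range'_1] at hi
    exact hpos i (by omega) (by omega)

/-! ### Positivity of the external data -/

/-- Vectors of the plane winding by less than a half turn: if consecutive brackets and all
brackets with the first vector are positive, so are all brackets. -/
theorem two_bracket_pos_of_first {b : ℕ → ℕ → ℝ}
    (hb : ∀ i j k l, b i j * b k l - b i k * b j l + b i l * b j k = 0) {p q : ℕ}
    (hcons : ∀ k, p ≤ k → k + 1 ≤ q → 0 < b k (k + 1)) (hfirst : ∀ k, p < k → k ≤ q → 0 < b p k)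
    {j k : ℕ} (hpj : p ≤ j) (hjk : j < k) (hkq : k ≤ q) : 0 < b j k := by
  induction k, hjk using Nat.le_induction with
  | base => exact hcons j hpj hkq
  | succ k hjk ih =>
    have hk := ih (by omega)
    rcases hpj.eq_or_lt with rfl | hpj
    · exact hfirst _ (by omega) hkq
    · have h1 := hfirst k (by omega) (by omega)
      have h2 := hfirst (k + 1) (by omega) hkq
      have h3 := hfirst j hpj (by omega)
      have h4 := hcons k (by omega) hkq
      -- The Plücker relation for `p < j < k < k + 1`; every bracket on the right is already known
      -- to be positive.
      have h5 : b p k * b j (k + 1) = b p j * b k (k + 1) + b p (k + 1) * b j k := by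
        linarith [hb p j k (k + 1)]
      exact (pos_iff_pos_of_mul_pos (h5 ▸ by positivity)).1 h1

/-- As `two_bracket_pos_of_first`, for the last vector. -/
theorem two_bracket_pos_of_last {b : ℕ → ℕ → ℝ}
    (hb : ∀ i j k l, b i j * b k l - b i k * b j l + b i l * b j k = 0) {p q : ℕ}
    (hcons : ∀ k, p ≤ k → k + 1 ≤ q → 0 < b k (k + 1)) (hlast : ∀ k, p ≤ k → k < q → 0 < b k q)
    {j k : ℕ} (hpj : p ≤ j) (hjk : j < k) (hkq : k ≤ q) : 0 < b j k := by
  obtain ⟨d, rfl⟩ : ∃ d, k = j + 1 + d := ⟨k - (j + 1), by omega⟩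
  induction d generalizing j with
  | zero => exact hcons j hpj hkq
  | succ d ih =>
    have hk := ih (j := j + 1) (by omega) (by omega) (by omega)
    rw [show j + 1 + 1 + d = j + 1 + (d + 1) by omega] at hk
    rcases hkq.eq_or_lt with h | hkq
    · rw [h]; exact hlast _ hpj (by omega)
    · have h1 := hlast (j + 1) (by omega) (by omega)
      have h2 := hlast j (by omega) (by omega)
      have h3 := hlast (j + 1 + (d + 1)) (by omega) hkq
      have h4 := hcons j hpj (by omega)
      have h5 : b (j + 1) q * b j (j + 1 + (d + 1)) =
          b j (j + 1) * b (j + 1 + (d + 1)) q + b j q * b (j + 1) (j + 1 + (d + 1)) := by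
        linarith [hb j (j + 1) (j + 1 + (d + 1)) q]
      exact (pos_iff_pos_of_mul_pos (h5 ▸ by positivity)).1 h1

/-- The twisted cyclic extension of the external data. -/
def twisted (n : ℕ) (Z : ℕ → Twistor) (i : ℕ) : Twistor := if i ≤ n then Z i else -Z (i - n)

variable {n : ℕ} {Z : ℕ → Twistor}

/-- The two-bracket `⟨12ij⟩`. -/
def twoBracket (Z : ℕ → Twistor) (i j : ℕ) : ℝ := bracket (Z 1) (Z 2) (Z i) (Z j)

theorem twoBracket_pluecker (Z : ℕ → Twistor) (i j k l : ℕ) :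
    twoBracket Z i j * twoBracket Z k l - twoBracket Z i k * twoBracket Z j l +
      twoBracket Z i l * twoBracket Z j k = 0 := bracket_pluecker _ _ _ _ _ _

theorem twoBracket_self (Z : ℕ → Twistor) (i : ℕ) : twoBracket Z i i = 0 := bracket_self _ _ _

/-- The flip condition gives only `⟨123k⟩ ≥ 0`. A zero would propagate: by a Plücker relation among
nonnegative terms `⟨123l⟩ = 0` forces `⟨123l+1⟩ = 0`, up to `⟨123n⟩`, which is positive by the
twisted cyclic condition (by the consecutive one when `n = 4`). -/
theorem IsMHVData.twoBracket_three_pos (hZ : IsMHVData n Z) (hn : 4 ≤ n) {k : ℕ} (h3 : 3 < k)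
    (hk : k ≤ n) : 0 < twoBracket Z 3 k := by
  have hcons : ∀ k, 3 ≤ k → k + 1 ≤ n → 0 < twoBracket Z k (k + 1) := fun k h1 h2 =>
    hZ.pos 1 k le_rfl (by omega) h2
  have hnn : ∀ k, 4 ≤ k → k ≤ n → 0 ≤ twoBracket Z 3 k := by
    have h := hZ.flips
    rw [show n - 3 = (n - 4) + 1 by omega, List.range'_succ, List.map_cons] at h
    intro k h4 hk
    rcases h4.eq_or_lt with rfl | h4
    · exact (hcons 3 le_rfl hn).le
    · refine nonneg_of_signFlips_eq_zero _ _ (hcons 3 le_rfl hn) h _ (List.mem_map.2 ⟨k, ?_, rfl⟩)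
      rw [List.mem_range'_1]
      omega
  have hlast : 0 < twoBracket Z 3 n := by
    rcases hn.eq_or_lt with rfl | hn
    · exact hcons 3 le_rfl le_rfl
    · have := hZ.wrap 2 le_rfl (by omega)
      rwa [bracket_neg_right, bracket_rotate, neg_neg] at this
  refine (hnn _ h3 hk).lt_of_ne' fun h0 => ?_
  have key : ∀ l, k ≤ l → l ≤ n → twoBracket Z 3 l = 0 := by
    intro l hkl
    induction l, hkl using Nat.le_induction with
    | base => exact fun _ => h0
    | succ l hkl ih =>
      intro hl
      obtain ⟨m, rfl⟩ : ∃ m, l = m + 1 := ⟨l - 1, by omega⟩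
      have h1 := hcons m (by omega) (by omega)
      have h2 := hcons (m + 1) (by omega) (by omega)
      have h5 : 0 ≤ twoBracket Z 3 m := by
        rcases (show 3 ≤ m by omega).eq_or_lt with rfl | h
        · exact (twoBracket_self Z 3).ge
        · exact hnn m h (by omega)
      have h6 := hnn (m + 1 + 1) (by omega) hl
      have h7 := twoBracket_pluecker Z 3 m (m + 1) (m + 1 + 1)
      rw [ih (by omega), zero_mul, sub_zero] at h7
      refine (h6.eq_or_lt).elim Eq.symm fun this => ?_
      linarith [mul_pos this h1, mul_nonneg h5 h2.le]
  exact hlast.ne' (key n hk le_rfl)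

theorem IsMHVData.twoBracket_pos (hZ : IsMHVData n Z) (hn : 4 ≤ n) {j k : ℕ} (h3 : 3 ≤ j)
    (hjk : j < k) (hk : k ≤ n) : 0 < twoBracket Z j k :=
  two_bracket_pos_of_first (twoBracket_pluecker Z)
    (fun k h1 h2 => hZ.pos 1 k le_rfl (by omega) h2)
    (fun _ h1 h2 => hZ.twoBracket_three_pos hn h1 h2) h3 hjk hk


theorem twisted_of_le {i : ℕ} (hi : i ≤ n) : twisted n Z i = Z i := if_pos hi

theorem twisted_of_gt {i : ℕ} (hi : n < i) : twisted n Z i = -Z (i - n) := if_neg hi.not_ge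

theorem IsMHVData.consecutive_pos (hZ : IsMHVData n Z) {i k : ℕ} (hi : 1 ≤ i) (hin : i + 1 ≤ n)
    (hik : i + 2 ≤ k) (hk : k + 1 ≤ i + n - 1) :
    0 < bracket (Z i) (Z (i + 1)) (twisted n Z k) (twisted n Z (k + 1)) := by
  rcases lt_trichotomy k n with h | rfl | h
  · rw [twisted_of_le h.le, twisted_of_le h]
    exact hZ.pos i k hi hik h
  · rw [twisted_of_le le_rfl, twisted_of_gt (show k < k + 1 by omega), Nat.add_sub_cancel_left]
    exact hZ.wrap i (by omega) (by omega)
  · rw [twisted_of_gt h, twisted_of_gt (by omega), bracket_neg_right, bracket_neg_third, neg_neg,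
      bracket_swap_pairs, show k + 1 - n = k - n + 1 by omega]
    exact hZ.pos (k - n) i (by omega) (by omega) hin

/-- All brackets `⟨i i+1 j k⟩` in twisted cyclic order are positive. -/
theorem IsMHVData.bracket_pos (hZ : IsMHVData n Z) (hn : 4 ≤ n) {i : ℕ} (hi : 1 ≤ i)
    (hin : i + 2 ≤ n) : ∀ j k, i + 2 ≤ j → j < k → k ≤ i + n - 1 →
      0 < bracket (Z i) (Z (i + 1)) (twisted n Z j) (twisted n Z k) := by
  induction i, hi using Nat.le_induction with
  | base =>
    intro j k hj hjk hk
    rw [twisted_of_le (by omega), twisted_of_le (by omega)]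
    exact hZ.twoBracket_pos hn hj hjk (by omega)
  | succ i hi ih =>
    intro j k hj hjk hk
    -- Projecting through the next edge, the last vector is the twisted `-Z i`; its brackets `⟨i+1
    -- i+2 k -i⟩` equal `⟨i i+1 i+2 k⟩`, which are known from the preceding edge.
    refine two_bracket_pos_of_last (p := i + 1 + 2) (q := i + n)
      (b := fun j k => bracket (Z (i + 1)) (Z (i + 1 + 1)) (twisted n Z j) (twisted n Z k))
      (fun _ _ _ _ => bracket_pluecker _ _ _ _ _ _)
      (fun k h1 h2 => hZ.consecutive_pos (by omega) (by omega) h1 (by omega))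
      (fun k h1 h2 => ?_) hj hjk (by omega)
    have := ih (by omega) (i + 2) k le_rfl (by omega) (by omega)
    rw [twisted_of_le (by omega)] at this
    rw [twisted_of_gt (show n < i + n by omega), Nat.add_sub_cancel, bracket_neg_right,
      bracket_rotate, neg_neg]
    exact this

theorem IsMHVData.bracket_one_pos (hZ : IsMHVData n Z) (hn : 4 ≤ n) {i : ℕ} (hi : 3 ≤ i)
    (hin : i + 2 ≤ n) : 0 < bracket (Z 1) (Z i) (Z (i + 1)) (Z (i + 2)) := by
  have := hZ.bracket_pos hn (show 1 ≤ i by omega) hin (i + 2) (n + 1) le_rfl (by omega) (by omega)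
  rwa [twisted_of_le hin, twisted_of_gt (show n < n + 1 by omega), Nat.add_sub_cancel_left,
    bracket_neg_right, bracket_rotate, neg_neg] at this

theorem IsMHVData.bracket_two_pos (hZ : IsMHVData n Z) (hn : 4 ≤ n) {i : ℕ} (hi : 3 ≤ i)
    (hin : i + 2 ≤ n) : 0 < bracket (Z 2) (Z i) (Z (i + 1)) (Z (i + 2)) := by
  rcases hi.eq_or_lt with rfl | hi
  · exact hZ.pos 2 4 (by omega) (by omega) hin
  have := hZ.bracket_pos hn (show 1 ≤ i by omega) hin (i + 2) (n + 2) le_rfl (by omega) (by omega)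
  rwa [twisted_of_le hin, twisted_of_gt (by omega), Nat.add_sub_cancel_left,
    bracket_neg_right, bracket_rotate, neg_neg] at this

/-! ### Brackets on the cut -/

/-- `⟨AB1i⟩ / x` on the cut. -/
def sideForm (n : ℕ) (Z : ℕ → Twistor) (i : ℕ) (t : ℝ) : ℝ :=
  twoBracket Z 3 i - t * twoBracket Z i n

/-- The value of `σ` at which `⟨ABii+1⟩` vanishes. -/
def sWall (n : ℕ) (Z : ℕ → Twistor) (i : ℕ) (t x : ℝ) : ℝ :=
  -bracket (pointA Z x) (pointB n Z 0 t) (Z i) (Z (i + 1)) / (x * twoBracket Z i (i + 1))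

theorem bracket_cut_one (s t x : ℝ) (i : ℕ) :
    bracket (pointA Z x) (pointB n Z s t) (Z 1) (Z i) = x * sideForm n Z i t := by
  simp only [bracket_eq, pointA, pointB, sideForm, twoBracket, Pi.add_apply, Pi.sub_apply,
    Pi.smul_apply, smul_eq_mul]; ring

theorem bracket_cut_two_three (s t x : ℝ) :
    bracket (pointA Z x) (pointB n Z s t) (Z 2) (Z 3) = t * twoBracket Z 3 n := by
  simp only [bracket_eq, pointA, pointB, twoBracket, Pi.add_apply, Pi.sub_apply,
    Pi.smul_apply, smul_eq_mul]; ring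

theorem bracket_cut_last (s t x : ℝ) :
    bracket (pointA Z x) (pointB n Z s t) (Z n) (-Z 1) = x * twoBracket Z 3 n := by
  rw [bracket_neg_right, bracket_swap_right, neg_neg, bracket_cut_one, sideForm, twoBracket_self,
    mul_zero, sub_zero]

theorem bracket_cut_edge_add (s t x : ℝ) (i : ℕ) :
    bracket (pointA Z x) (pointB n Z s t) (Z i) (Z (i + 1)) =
      s * x * twoBracket Z i (i + 1) +
        bracket (pointA Z x) (pointB n Z 0 t) (Z i) (Z (i + 1)) := by
  simp only [bracket_eq, pointA, pointB, twoBracket, Pi.add_apply, Pi.sub_apply,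
    Pi.smul_apply, smul_eq_mul]; ring

theorem bracket_cut_edge (s t : ℝ) {x : ℝ} {i : ℕ} (hx : x ≠ 0)
    (hi : twoBracket Z i (i + 1) ≠ 0) :
    bracket (pointA Z x) (pointB n Z s t) (Z i) (Z (i + 1)) =
      x * twoBracket Z i (i + 1) * (s - sWall n Z i t x) := by
  rw [bracket_cut_edge_add, sWall]
  field_simp
  ring

/-- This factorization decouples the problem: mutual positivity does not involve `σ`, and it says
that `x` and `t` order the two loops oppositely. -/
theorem bracket_cut_cut (s t x s' t' x' : ℝ) :
    bracket (pointA Z x) (pointB n Z s t) (pointA Z x') (pointB n Z s' t') =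
      (x - x') * (t' - t) * twoBracket Z 3 n := by
  simp only [bracket_eq, pointA, pointB, twoBracket, Pi.add_apply, Pi.sub_apply,
    Pi.smul_apply, smul_eq_mul]; ring

theorem bracket_cut_one_edge (x : ℝ) (i : ℕ) :
    bracket (pointA Z x) (Z 1) (Z i) (Z (i + 1)) = -(x * twoBracket Z i (i + 1)) := by
  simp only [bracket_eq, pointA, twoBracket, Pi.add_apply, Pi.smul_apply, smul_eq_mul]; ring

/-- The line `(AB)` seen from `A` against two consecutive edges of the polygon. -/
theorem edge_relation (A B o p i s : Twistor) :
    bracket A B o i * bracket A p i s =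
      bracket A B p i * bracket A o i s - bracket A B i s * bracket A o p i := by
  have h := bracket_pluecker A i B o p s
  rw [← bracket_rotate_right A i B o, ← bracket_rotate_right A i B p,
    bracket_swap_middle A p i s, bracket_swap_middle A B i s, bracket_swap_middle A o i s,
    ← bracket_rotate_right A i o p] at h
  linarith

theorem bracket_cut_triple_pos (hZ : IsMHVData n Z) (hn : 4 ≤ n) {x : ℝ} (hx : 0 < x) {i : ℕ}
    (hi : 3 ≤ i) (hin : i + 2 ≤ n) :
    0 < bracket (pointA Z x) (Z i) (Z (i + 1)) (Z (i + 2)) := by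
  have h : bracket (pointA Z x) (Z i) (Z (i + 1)) (Z (i + 2)) =
      bracket (Z 1) (Z i) (Z (i + 1)) (Z (i + 2)) +
        x * bracket (Z 2) (Z i) (Z (i + 1)) (Z (i + 2)) := by
    simp only [bracket_eq, pointA, Pi.add_apply, Pi.smul_apply, smul_eq_mul]; ring
  rw [h]
  have := hZ.bracket_one_pos hn hi hin
  have := hZ.bracket_two_pos hn hi hin
  positivity

/-- `edge_relation` at `σ = 0`, read as a comparison of neighbouring walls. By positivity of the
remaining factors the sign of the difference is that of `⟨AB1i+1⟩`, which is what makes the sequence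
of walls unimodal. -/
theorem sWall_succ_sub (hx : (x : ℝ) ≠ 0) {i : ℕ} (t : ℝ) (h1 : twoBracket Z i (i + 1) ≠ 0)
    (h2 : twoBracket Z (i + 1) (i + 2) ≠ 0) :
    (sWall n Z i t x - sWall n Z (i + 1) t x) *
      (x * twoBracket Z i (i + 1) * twoBracket Z (i + 1) (i + 2)) =
      sideForm n Z (i + 1) t * bracket (pointA Z x) (Z i) (Z (i + 1)) (Z (i + 2)) := by
  have h := edge_relation (pointA Z x) (pointB n Z 0 t) (Z 1) (Z i) (Z (i + 1)) (Z (i + 2))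
  rw [bracket_cut_one, bracket_cut_one_edge, bracket_cut_one_edge,
    bracket_cut_edge (i := i) _ _ hx h1, bracket_cut_edge (i := i + 1) _ _ hx h2] at h
  refine mul_left_cancel₀ hx ?_
  rw [← mul_assoc x (sideForm _ _ _ _), h]
  ring

/-- In the `j`-th interval of `t`, the wall of the `j`-th edge is the uppermost one. -/
theorem sWall_le (hZ : IsMHVData n Z) (hn : 4 ≤ n) {x t : ℝ} (hx : 0 < x) {i j : ℕ} (hi : 3 ≤ i)
    (hin : i + 1 ≤ n) (hj : 3 ≤ j) (hjn : j + 1 ≤ n)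
    (hneg : ∀ k, 3 ≤ k → k ≤ j → sideForm n Z k t < 0)
    (hpos : ∀ k, j < k → k ≤ n → 0 < sideForm n Z k t) :
    sWall n Z i t x ≤ sWall n Z j t x := by
  have hstep : ∀ k, 3 ≤ k → k + 2 ≤ n → 0 < x * twoBracket Z k (k + 1) *
      twoBracket Z (k + 1) (k + 2) ∧ (sWall n Z k t x - sWall n Z (k + 1) t x) *
      (x * twoBracket Z k (k + 1) * twoBracket Z (k + 1) (k + 2)) = sideForm n Z (k + 1) t *
        bracket (pointA Z x) (Z k) (Z (k + 1)) (Z (k + 2)) := by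
    intro k h1 h2
    have e1 := hZ.twoBracket_pos hn h1 (Nat.lt_succ_self k) (by omega)
    have e2 := hZ.twoBracket_pos hn (show 3 ≤ k + 1 by omega) (Nat.lt_succ_self (k + 1)) h2
    exact ⟨mul_pos (mul_pos hx e1) e2, sWall_succ_sub hx.ne' t e1.ne' e2.ne'⟩
  rcases le_total i j with hij | hij
  · have key : ∀ k, i ≤ k → k ≤ j → sWall n Z i t x ≤ sWall n Z k t x := by
      intro k hik
      induction k, hik using Nat.le_induction with
      | base => exact fun _ => le_rfl
      | succ k hik ih =>
        intro hk
        refine (ih (by omega)).trans ?_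
        obtain ⟨h1, h2⟩ := hstep k (by omega) (by omega)
        have h3 := hneg (k + 1) (by omega) hk
        have h4 := bracket_cut_triple_pos hZ hn hx (show 3 ≤ k by omega) (by omega)
        have h5 := mul_neg_of_neg_of_pos h3 h4
        rw [← h2] at h5
        exact (sub_neg.1 (neg_of_mul_neg_left h5 h1.le)).le
    exact key j hij le_rfl
  · induction i, hij using Nat.le_induction with
    | base => exact le_rfl
    | succ i hij ih =>
      refine le_trans ?_ (ih (by omega) (by omega))
      obtain ⟨h1, h2⟩ := hstep i (by omega) (by omega)
      have h3 := hpos (i + 1) (by omega) (by omega)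
      have h4 := bracket_cut_triple_pos hZ hn hx (show 3 ≤ i by omega) (by omega)
      have h5 := mul_pos h3 h4
      rw [← h2] at h5
      exact (sub_pos.1 (pos_of_mul_pos_left h5 h1.le)).le

/-! ### The ladder region -/

theorem nonneg_of_mem_closure {L : ℕ} {ℓ : Fin L → Twistor × Twistor}
    (hℓ : ℓ ∈ closure (amplituhedron n Z L)) {f : (Fin L → Twistor × Twistor) → ℝ}
    (hf : Continuous f) (h : ∀ ℓ ∈ amplituhedron n Z L, 0 < f ℓ) : 0 ≤ f ℓ :=
  closure_minimal (fun ℓ hℓ => (h ℓ hℓ).le) (isClosed_le continuous_const hf) hℓ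

theorem sideForm_three (t : ℝ) : sideForm n Z 3 t = -(t * twoBracket Z 3 n) := by
  rw [sideForm, twoBracket_self, zero_sub]

theorem sideForm_last (t : ℝ) : sideForm n Z n t = twoBracket Z 3 n := by
  rw [sideForm, twoBracket_self, mul_zero, sub_zero]

/-- For `t < 0` the sequence `⟨AB1i⟩ / x`, `i ≥ 3`, has no sign change; this excludes the wrong
orientation of a line and provides a point off all the side walls. -/
theorem sideForm_pos_of_neg (hZ : IsMHVData n Z) (hn : 4 ≤ n) {t : ℝ} (ht : t < 0) {i : ℕ}
    (hi : 3 ≤ i) (hin : i ≤ n) : 0 < sideForm n Z i t := by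
  rcases hi.eq_or_lt with rfl | h
  · rw [sideForm_three, ← neg_mul]
    exact mul_pos (neg_pos.2 ht) (hZ.twoBracket_pos hn le_rfl (by omega) le_rfl)
  · have h1 := hZ.twoBracket_pos hn le_rfl h hin
    rcases hin.eq_or_lt with rfl | hin
    · rwa [sideForm_last]
    · have h2 := hZ.twoBracket_pos hn hi hin le_rfl
      rw [sideForm]
      nlinarith

/-- Each strict inequality on the amplituhedron becomes weak on its closure, and strict again off
the walls. What remains is to exclude the orientation `ε = -1`. -/
theorem mem_ladderRegion_imp (hZ : IsMHVData n Z) (hn : 4 ≤ n) {L : ℕ} {u : Fin (3 * L) → ℝ}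
    (hx : ∀ α, xCoord u α ≠ 0) (ht : ∀ α, tCoord u α ≠ 0)
    (hs : ∀ α i, 3 ≤ i → i + 1 ≤ n → sCoord u α ≠ sWall n Z i (tCoord u α) (xCoord u α))
    (hxx : ∀ α β, α < β → xCoord u α ≠ xCoord u β)
    (htt : ∀ α β, α < β → tCoord u α ≠ tCoord u β) (hu : u ∈ ladderRegion n Z L) :
    (∀ α, 0 < xCoord u α ∧ 0 < tCoord u α ∧
      ∀ i, 3 ≤ i → i + 1 ≤ n → sWall n Z i (tCoord u α) (xCoord u α) < sCoord u α) ∧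
      ∀ α β, α < β → 0 < (xCoord u α - xCoord u β) * (tCoord u β - tCoord u α) := by
  obtain ⟨ε, hε, hu⟩ := hu
  have hb := hZ.twoBracket_pos hn le_rfl (show 3 < n by omega) le_rfl
  have hε1 : ∀ α, ε α = 1 ∧ 0 < xCoord u α ∧ 0 < tCoord u α := by
    intro α
    have h1 : 0 ≤ ε α * (xCoord u α * twoBracket Z 3 n) := by
      have := nonneg_of_mem_closure hu
        (f := fun ℓ => bracket (ℓ α).1 (ℓ α).2 (Z n) (-Z 1))
        (continuous_bracket (by fun_prop) (by fun_prop) (by fun_prop) (by fun_prop))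
        fun ℓ hℓ => (hℓ.1 α).wrap
      simpa only [bracket_smul_second, bracket_cut_last] using this
    have h2 : 0 ≤ ε α * (tCoord u α * twoBracket Z 3 n) := by
      have := nonneg_of_mem_closure hu
        (f := fun ℓ => bracket (ℓ α).1 (ℓ α).2 (Z 2) (Z 3))
        (continuous_bracket (by fun_prop) (by fun_prop) (by fun_prop) (by fun_prop))
        fun ℓ hℓ => (hℓ.1 α).pos 2 (by omega) (by omega)
      simpa only [bracket_smul_second, bracket_cut_two_three] using this
    rcases hε α with h | h
    · rw [h, one_mul] at h1 h2
      exact ⟨h, (nonneg_of_mul_nonneg_left h1 hb).lt_of_ne' (hx α),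
        (nonneg_of_mul_nonneg_left h2 hb).lt_of_ne' (ht α)⟩
    · exfalso
      rw [h, neg_one_mul, neg_nonneg] at h1 h2
      have hx' : xCoord u α < 0 := (nonpos_of_mul_nonpos_left h1 hb).lt_of_ne (hx α)
      have ht' : tCoord u α < 0 := (nonpos_of_mul_nonpos_left h2 hb).lt_of_ne (ht α)
      -- With `ε = -1` both `x` and `t` are negative, so all `⟨AB1i⟩` with `i ≥ 3` are positive.
      -- This is an open condition, hence holds at a nearby amplituhedron point, where also `⟨AB12⟩
      -- > 0`: no flips instead of two.
      have hopen : IsOpen {ℓ : Fin L → Twistor × Twistor |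
          ∀ i ∈ Finset.Icc 3 n, 0 < bracket (ℓ α).1 (ℓ α).2 (Z 1) (Z i)} := by
        simp only [Set.ofPred_forall]
        exact isOpen_biInter_finset fun i _ => isOpen_lt continuous_const
          (continuous_bracket (by fun_prop) (by fun_prop) (by fun_prop) (by fun_prop))
      obtain ⟨ℓ, hℓ1, hℓ2⟩ := mem_closure_iff.1 hu _ hopen (by
        intro i hi
        rw [Finset.mem_Icc] at hi
        rw [bracket_smul_second, bracket_cut_one, h, neg_one_mul, ← neg_mul]
        exact mul_pos (neg_pos.2 hx') (sideForm_pos_of_neg hZ hn ht' hi.1 hi.2))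
      have hflip := (hℓ2.1 α).flips
      rw [signFlips_eq_zero_of_pos] at hflip
      · exact absurd hflip (by norm_num)
      · intro y hy
        obtain ⟨i, hi, rfl⟩ := List.mem_map.1 hy
        rw [List.mem_range'_1] at hi
        rcases hi.1.eq_or_lt with rfl | hi2
        · exact (hℓ2.1 α).pos 1 le_rfl (by omega)
        · exact hℓ1 i (Finset.mem_Icc.2 ⟨hi2, by omega⟩)
  refine ⟨fun α => ⟨(hε1 α).2.1, (hε1 α).2.2, fun i h1 h2 => ?_⟩, fun α β hαβ => ?_⟩
  · have := nonneg_of_mem_closure hu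
      (f := fun ℓ => bracket (ℓ α).1 (ℓ α).2 (Z i) (Z (i + 1)))
      (continuous_bracket (by fun_prop) (by fun_prop) (by fun_prop) (by fun_prop))
      fun ℓ hℓ => (hℓ.1 α).pos i (by omega) h2
    have hg := hZ.twoBracket_pos hn h1 (Nat.lt_succ_self i) h2
    simp only [bracket_smul_second, (hε1 α).1, one_mul] at this
    rw [bracket_cut_edge _ _ (hx α) hg.ne'] at this
    have h3 := nonneg_of_mul_nonneg_right this (mul_pos (hε1 α).2.1 hg)
    exact (sub_nonneg.1 h3).lt_of_ne' (hs α i h1 h2)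
  · have := nonneg_of_mem_closure hu
      (f := fun ℓ => bracket (ℓ α).1 (ℓ α).2 (ℓ β).1 (ℓ β).2)
      (continuous_bracket (by fun_prop) (by fun_prop) (by fun_prop) (by fun_prop))
      fun ℓ hℓ => hℓ.2 α β hαβ
    simp only [bracket_smul_second, bracket_smul_right, (hε1 α).1, (hε1 β).1, one_mul,
      bracket_cut_cut] at this
    exact (nonneg_of_mul_nonneg_left this hb).lt_of_ne'
      (mul_ne_zero (sub_ne_zero.2 (hxx α β hαβ)) (sub_ne_zero.2 (htt α β hαβ).symm))

theorem mem_ladderRegion_of (hZ : IsMHVData n Z) (hn : 4 ≤ n) {L : ℕ} {u : Fin (3 * L) → ℝ}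
    (j : Fin L → ℕ) (hj : ∀ α, 3 ≤ j α ∧ j α + 1 ≤ n)
    (hneg : ∀ α k, 3 ≤ k → k ≤ j α → sideForm n Z k (tCoord u α) < 0)
    (hpos : ∀ α k, j α < k → k ≤ n → 0 < sideForm n Z k (tCoord u α))
    (hx : ∀ α, 0 < xCoord u α) (ht : ∀ α, 0 < tCoord u α)
    (hs : ∀ α i, 3 ≤ i → i + 1 ≤ n → sWall n Z i (tCoord u α) (xCoord u α) < sCoord u α)
    (hxt : ∀ α β, α < β → 0 < (xCoord u α - xCoord u β) * (tCoord u β - tCoord u α)) :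
    u ∈ ladderRegion n Z L := by
  refine ⟨fun _ => 1, fun _ => Or.inl rfl, ?_⟩
  have hb := hZ.twoBracket_pos hn le_rfl (show 3 < n by omega) le_rfl
  -- On the cut only `⟨AB12⟩` degenerates. Moving `A` by `-δ Z n` makes it `δ⟨123n⟩ > 0`, while the
  -- other inequalities and the signs of `⟨AB1i⟩` are strict at `δ = 0` and persist for small `δ`.
  set p : ℝ → Fin L → Twistor × Twistor := fun δ α =>
    (pointA Z (xCoord u α) - δ • Z n, pointB n Z (sCoord u α) (tCoord u α)) with hp
  have hpc : Continuous p := by fun_prop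
  have hp0 : p 0 = fun α => (pointA Z (xCoord u α),
      (1 : ℝ) • pointB n Z (sCoord u α) (tCoord u α)) := by
    simp [hp]
  rw [← hp0]
  have hev : ∀ f : (Fin L → Twistor × Twistor) → ℝ, Continuous f → 0 < f (p 0) →
      ∀ᶠ δ in nhdsWithin (0 : ℝ) (Set.Ioi 0), 0 < f (p δ) := fun f hf h =>
    nhdsWithin_le_nhds ((hf.comp hpc).continuousAt.eventually (lt_mem_nhds h))
  refine mem_closure_of_tendsto (b := nhdsWithin (0 : ℝ) (Set.Ioi 0))
    (hpc.continuousAt.tendsto.mono_left nhdsWithin_le_nhds) ?_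
  have hmut : ∀ᶠ δ in nhdsWithin (0 : ℝ) (Set.Ioi 0), ∀ α β, α < β →
      0 < bracket (p δ α).1 (p δ α).2 (p δ β).1 (p δ β).2 := by
    refine Filter.eventually_all.2 fun α => Filter.eventually_all.2 fun β => ?_
    by_cases hαβ : α < β
    · refine (hev (fun ℓ => bracket (ℓ α).1 (ℓ α).2 (ℓ β).1 (ℓ β).2)
        (continuous_bracket (by fun_prop) (by fun_prop) (by fun_prop) (by fun_prop)) ?_).mono
        fun δ h _ => h
      simp only [hp, zero_smul, sub_zero, bracket_cut_cut]
      exact mul_pos (hxt α β hαβ) hb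
    · exact Filter.Eventually.of_forall fun _ h => absurd h hαβ
  have h12 : ∀ δ α, bracket (p δ α).1 (p δ α).2 (Z 1) (Z 2) = δ * twoBracket Z 3 n := by
    intro δ α
    simp only [hp, bracket_eq, pointA, pointB, twoBracket, Pi.add_apply, Pi.sub_apply,
      Pi.smul_apply, smul_eq_mul]
    ring
  have hedge : ∀ᶠ δ in nhdsWithin (0 : ℝ) (Set.Ioi 0), ∀ α, ∀ i ∈ Finset.Icc 2 (n - 1),
      0 < bracket (p δ α).1 (p δ α).2 (Z i) (Z (i + 1)) := by
    refine Filter.eventually_all.2 fun α => (Filter.eventually_all_finset _).2 fun i hi => ?_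
    rw [Finset.mem_Icc] at hi
    refine hev (fun ℓ => bracket (ℓ α).1 (ℓ α).2 (Z i) (Z (i + 1)))
      (continuous_bracket (by fun_prop) (by fun_prop) (by fun_prop) (by fun_prop)) ?_
    simp only [hp, zero_smul, sub_zero]
    rcases hi.1.eq_or_lt with rfl | h3
    · rw [bracket_cut_two_three]
      exact mul_pos (ht α) hb
    · have hg := hZ.twoBracket_pos hn h3 (Nat.lt_succ_self i) (by omega)
      rw [bracket_cut_edge _ _ (hx α).ne' hg.ne']
      exact mul_pos (mul_pos (hx α) hg) (sub_pos.2 (hs α i h3 (by omega)))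
  have hwrap : ∀ᶠ δ in nhdsWithin (0 : ℝ) (Set.Ioi 0), ∀ α,
      0 < bracket (p δ α).1 (p δ α).2 (Z n) (-Z 1) := by
    refine Filter.eventually_all.2 fun α => hev (fun ℓ => bracket (ℓ α).1 (ℓ α).2 (Z n) (-Z 1))
      (continuous_bracket (by fun_prop) (by fun_prop) (by fun_prop) (by fun_prop)) ?_
    simp only [hp, zero_smul, sub_zero, bracket_cut_last]
    exact mul_pos (hx α) hb
  have hfneg : ∀ᶠ δ in nhdsWithin (0 : ℝ) (Set.Ioi 0), ∀ α, ∀ i ∈ Finset.Icc 3 (j α),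
      0 < -bracket (p δ α).1 (p δ α).2 (Z 1) (Z i) := by
    refine Filter.eventually_all.2 fun α => (Filter.eventually_all_finset _).2 fun i hi => ?_
    rw [Finset.mem_Icc] at hi
    refine hev (fun ℓ => -bracket (ℓ α).1 (ℓ α).2 (Z 1) (Z i))
      (continuous_bracket (by fun_prop) (by fun_prop) (by fun_prop) (by fun_prop)).neg ?_
    simp only [hp, zero_smul, sub_zero, bracket_cut_one]
    exact neg_pos.2 (mul_neg_of_pos_of_neg (hx α) (hneg α i hi.1 hi.2))
  have hfpos : ∀ᶠ δ in nhdsWithin (0 : ℝ) (Set.Ioi 0), ∀ α, ∀ i ∈ Finset.Icc (j α + 1) n,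
      0 < bracket (p δ α).1 (p δ α).2 (Z 1) (Z i) := by
    refine Filter.eventually_all.2 fun α => (Filter.eventually_all_finset _).2 fun i hi => ?_
    rw [Finset.mem_Icc] at hi
    refine hev (fun ℓ => bracket (ℓ α).1 (ℓ α).2 (Z 1) (Z i))
      (continuous_bracket (by fun_prop) (by fun_prop) (by fun_prop) (by fun_prop)) ?_
    simp only [hp, zero_smul, sub_zero, bracket_cut_one]
    exact mul_pos (hx α) (hpos α i hi.1 hi.2)
  filter_upwards [hmut, hedge, hwrap, hfneg, hfpos, self_mem_nhdsWithin] with δ h1 h2 h3 h4 h5 h6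
  refine ⟨fun α => ⟨fun i hi hin => ?_, h3 α, ?_⟩, h1⟩
  · rcases hi.eq_or_lt with rfl | hi
    · rw [h12]
      exact mul_pos h6 hb
    · exact h2 α i (Finset.mem_Icc.2 ⟨hi, by omega⟩)
  · refine signFlips_range' _ (hj α).1 (hj α).2 ?_ (fun i hi hij => ?_) fun i hi hin => ?_
    · rw [h12]
      exact mul_pos h6 hb
    · exact neg_pos.1 (h4 α i (Finset.mem_Icc.2 ⟨hi, hij⟩))
    · exact h5 α i (Finset.mem_Icc.2 ⟨hi, hin⟩)

/-! ### Walls in the variable `t` -/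

/-- The value of `t` at which `⟨AB1i⟩` vanishes on the cut. -/
def tWall (n : ℕ) (Z : ℕ → Twistor) (i : ℕ) : ℝ := twoBracket Z 3 i / twoBracket Z i n

theorem sideForm_neg_iff (hZ : IsMHVData n Z) (hn : 4 ≤ n) {i : ℕ} (hi : 3 ≤ i) (hin : i < n)
    (t : ℝ) : sideForm n Z i t < 0 ↔ tWall n Z i < t := by
  rw [sideForm, tWall, sub_neg, div_lt_iff₀ (hZ.twoBracket_pos hn hi hin le_rfl)]

theorem sideForm_pos_iff (hZ : IsMHVData n Z) (hn : 4 ≤ n) {i : ℕ} (hi : 3 ≤ i) (hin : i < n)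
    (t : ℝ) : 0 < sideForm n Z i t ↔ t < tWall n Z i := by
  rw [sideForm, tWall, sub_pos, lt_div_iff₀ (hZ.twoBracket_pos hn hi hin le_rfl)]

/-- By the Plücker relation, the cross-multiplied difference is `⟨123n⟩⟨12ij⟩ > 0`. -/
theorem tWall_lt (hZ : IsMHVData n Z) (hn : 4 ≤ n) {i j : ℕ} (hi : 3 ≤ i) (hij : i < j)
    (hjn : j < n) : tWall n Z i < tWall n Z j := by
  have h1 := hZ.twoBracket_pos hn hi (hij.trans hjn) le_rfl
  have h2 := hZ.twoBracket_pos hn (hi.trans hij.le) hjn le_rfl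
  have h3 := hZ.twoBracket_pos hn hi hij hjn.le
  have h4 := hZ.twoBracket_pos hn le_rfl (show 3 < n by omega) le_rfl
  rw [tWall, tWall, div_lt_div_iff₀ h1 h2]
  have := twoBracket_pluecker Z 3 i j n
  nlinarith [mul_pos h3 h4]

theorem tWall_le (hZ : IsMHVData n Z) (hn : 4 ≤ n) {i j : ℕ} (hi : 3 ≤ i) (hij : i ≤ j)
    (hjn : j < n) : tWall n Z i ≤ tWall n Z j := by
  rcases hij.eq_or_lt with rfl | h
  exacts [le_rfl, (tWall_lt hZ hn hi h hjn).le]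

theorem sideForm_tWall (hZ : IsMHVData n Z) (hn : 4 ≤ n) {i : ℕ} (hi : 3 ≤ i) (hin : i < n) :
    sideForm n Z i (tWall n Z i) = 0 := by
  rw [sideForm, tWall, div_mul_cancel₀ _ (hZ.twoBracket_pos hn hi hin le_rfl).ne', sub_self]

/-- The right end of the `j`-th interval of `t`, if it is finite. -/
def upperWall (n : ℕ) (Z : ℕ → Twistor) (j : ℕ) : Option ℝ :=
  if j + 1 < n then some (tWall n Z (j + 1)) else none

theorem sideForm_succ_pos_iff (hZ : IsMHVData n Z) (hn : 4 ≤ n) {j : ℕ} (hj : 3 ≤ j)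
    (hjn : j + 1 ≤ n) (t : ℝ) :
    0 < sideForm n Z (j + 1) t ↔ ∀ h ∈ upperWall n Z j, t < h := by
  rw [upperWall]
  split_ifs with h
  · rw [sideForm_pos_iff hZ hn (by omega) h]
    simp
  · obtain rfl : j + 1 = n := by omega
    simp [sideForm_last, hZ.twoBracket_pos hn le_rfl (show 3 < j + 1 by omega) le_rfl]

/-! ### Products over links of a list -/

/-- The product of `ψ p a` over the entries `a` of a list, `p` being the preceding entry. -/
def linkProd {E : Type*} (ψ : Option E → E → ℝ) : Option E → List E → ℝ
  | _, [] => 1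
  | p, a :: l => ψ p a * linkProd ψ (some a) l

/-- Only the links next to the inserted entry change: `h` compares the two new links with the one
they replace. At the end of the list there is no following link, and its factor is `1`. -/
theorem linkProd_insert {E : Type*} (ψ : Option E → E → ℝ) (p : Option E) (l₁ l₂ : List E) (e : E)
    (c : ℝ) (h : ψ (l₁.getLast?.or p) e * l₂.head?.elim 1 (ψ (some e)) =
      l₂.head?.elim 1 (ψ (l₁.getLast?.or p)) * c) :
    linkProd ψ p (l₁ ++ e :: l₂) = linkProd ψ p (l₁ ++ l₂) * c := by
  induction l₁ generalizing p with
  | nil =>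
    cases l₂ with
    | nil => simpa [linkProd] using h
    | cons b l₂ =>
      simp only [List.getLast?_nil, Option.none_or, List.head?_cons, Option.elim] at h
      simp only [List.nil_append, linkProd]
      rw [← mul_assoc, h]
      ring
  | cons a l₁ ih =>
    simp only [List.cons_append, linkProd]
    rw [ih (some a), mul_assoc]
    have e1 : (a :: l₁).getLast?.or p = l₁.getLast?.or (some a) := by
      rw [List.getLast?_cons]
      cases l₁.getLast? <;> rfl
    rwa [e1] at h

/-! ### Cells of the ladder region -/

/-- The coordinates of a loop, together with the index of the interval containing its `t`. -/
structure Entry where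
  /-- the coordinate `σ` -/
  s : ℝ
  /-- the coordinate `t` -/
  t : ℝ
  /-- the coordinate `x` -/
  x : ℝ
  /-- the index of the interval of `t` -/
  j : ℕ

/-- The cell of loops whose `t` increases and whose `x` decreases along the list. -/
def InCell (n : ℕ) (Z : ℕ → Twistor) (D : List Entry) : Prop :=
  D.Pairwise (fun a b => a.t < b.t ∧ b.x < a.x) ∧
    ∀ e ∈ D, 0 < e.x ∧ sideForm n Z e.j e.t < 0 ∧ 0 < sideForm n Z (e.j + 1) e.t ∧
      sWall n Z e.j e.t e.x < e.s

/-- The lower end for `t` of an entry with index `j` following the entry `p`. -/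
def lowerT (n : ℕ) (Z : ℕ → Twistor) (p : Option Entry) (j : ℕ) : ℝ :=
  p.elim (tWall n Z j) fun p => if p.j = j then p.t else tWall n Z j

/-- The upper end for `t` of an entry with index `j` preceding the entry `q`. -/
def upperT (n : ℕ) (Z : ℕ → Twistor) (q : Option Entry) (j : ℕ) : Option ℝ :=
  q.elim (upperWall n Z j) fun q => if q.j = j then some q.t else upperWall n Z j

/-- The factor of the form of a cell for the variable `t`. -/
def linkT (n : ℕ) (Z : ℕ → Twistor) (p : Option Entry) (e : Entry) : ℝ :=
  sideForm n Z (e.j + 1) (lowerT n Z p e.j) /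
    (sideForm n Z (e.j + 1) e.t * (e.t - lowerT n Z p e.j))

/-- The factor of the form of a cell for the variable `x`. -/
def linkX (p : Option Entry) (e : Entry) : ℝ := 1 / (e.x - p.elim 0 Entry.x)

/-- The canonical form of a cell. -/
def cellForm (n : ℕ) (Z : ℕ → Twistor) (D : List Entry) : ℝ :=
  (D.map fun e => 1 / (e.s - sWall n Z e.j e.t e.x)).prod * linkProd linkX none D.reverse *
    linkProd (linkT n Z) none D

/-! ### Inserting one loop into a cell -/

section Insert

variable {D₁ D₂ : List Entry} {e : Entry}

theorem le_getLast (h : D₁.Pairwise fun a b : Entry => a.t < b.t ∧ b.x < a.x) {p : Entry}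
    (hp : D₁.getLast? = some p) : p ∈ D₁ ∧ ∀ a ∈ D₁, a.t ≤ p.t ∧ p.x ≤ a.x := by
  obtain ⟨D, rfl⟩ := List.getLast?_eq_some_iff.1 hp
  rw [List.pairwise_append] at h
  refine ⟨by simp, fun a ha => ?_⟩
  rcases List.mem_append.1 ha with ha | ha
  · have := h.2.2 a ha p (by simp)
    exact ⟨this.1.le, this.2.le⟩
  · rw [List.mem_singleton.1 ha]
    exact ⟨le_rfl, le_rfl⟩

theorem head_le (h : D₂.Pairwise fun a b : Entry => a.t < b.t ∧ b.x < a.x) {q : Entry}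
    (hq : D₂.head? = some q) : q ∈ D₂ ∧ ∀ b ∈ D₂, q.t ≤ b.t ∧ b.x ≤ q.x := by
  obtain ⟨D, rfl⟩ := List.head?_eq_some_iff.1 hq
  rw [List.pairwise_cons] at h
  refine ⟨by simp, fun b hb => ?_⟩
  rcases List.mem_cons.1 hb with rfl | hb
  · exact ⟨le_rfl, le_rfl⟩
  · exact ⟨(h.1 b hb).1.le, (h.1 b hb).2.le⟩

theorem pairwise_insert {E : Type*} {R : E → E → Prop} {l₁ l₂ : List E} {e : E} :
    (l₁ ++ e :: l₂).Pairwise R ↔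
      (l₁ ++ l₂).Pairwise R ∧ (∀ a ∈ l₁, R a e) ∧ ∀ b ∈ l₂, R e b := by
  simp only [List.pairwise_append, List.pairwise_cons, List.mem_cons, forall_eq_or_imp]
  constructor
  · rintro ⟨h1, ⟨h2, h3⟩, h4⟩
    exact ⟨⟨h1, h3, fun a ha => (h4 a ha).2⟩, fun a ha => (h4 a ha).1, h2⟩
  · rintro ⟨⟨h1, h3, h4⟩, h5, h2⟩
    exact ⟨h1, ⟨h2, h3⟩, fun a ha => ⟨h5 a ha, h4 a ha⟩⟩

/-- Only the last entry `p` before `e` matters, as it has the largest `t`. If it lies in the same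
interval then `p.t` is already beyond the left wall; otherwise it lies in an earlier interval, and
the left wall is beyond `p.t`. -/
theorem lowerT_lt_iff (hZ : IsMHVData n Z) (hn : 4 ≤ n) (hD : InCell n Z D₁)
    (hs : ∀ a ∈ D₁, 3 ≤ a.j ∧ a.j ≤ e.j) (hj : 3 ≤ e.j) (hjn : e.j + 1 ≤ n) :
    lowerT n Z D₁.getLast? e.j < e.t ↔ (∀ a ∈ D₁, a.t < e.t) ∧ sideForm n Z e.j e.t < 0 := by
  rw [sideForm_neg_iff hZ hn hj hjn]
  cases hp : D₁.getLast? with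
  | none =>
    rw [List.getLast?_eq_none_iff] at hp
    simp [hp, lowerT]
  | some p =>
    obtain ⟨hp1, hp2⟩ := le_getLast hD.1 hp
    obtain ⟨-, h1, h2, -⟩ := hD.2 p hp1
    obtain ⟨hs1, hs2⟩ := hs p hp1
    simp only [lowerT, Option.elim]
    split_ifs with hpj
    · rw [sideForm_neg_iff hZ hn hs1 (by omega), hpj] at h1
      exact ⟨fun h => ⟨fun a ha => (hp2 a ha).1.trans_lt h, h1.trans h⟩, fun h => h.1 p hp1⟩
    · have hlt : p.j + 1 ≤ e.j := by omega
      rw [sideForm_pos_iff hZ hn (by omega) (by omega)] at h2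
      have h3 := tWall_le hZ hn (show 3 ≤ p.j + 1 by omega) hlt (by omega)
      exact ⟨fun h => ⟨fun a ha => (hp2 a ha).1.trans_lt (h2.trans (h3.trans_lt h)), h⟩,
        fun h => h.2⟩

theorem lt_upperT_iff (hZ : IsMHVData n Z) (hn : 4 ≤ n) (hD : InCell n Z D₂)
    (hs : ∀ b ∈ D₂, b.j + 1 ≤ n ∧ e.j ≤ b.j) (hj : 3 ≤ e.j) (hjn : e.j + 1 ≤ n) :
    (∀ h ∈ upperT n Z D₂.head? e.j, e.t < h) ↔
      (∀ b ∈ D₂, e.t < b.t) ∧ 0 < sideForm n Z (e.j + 1) e.t := by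
  cases hq : D₂.head? with
  | none =>
    rw [List.head?_eq_none_iff] at hq
    simp [hq, upperT, sideForm_succ_pos_iff hZ hn hj hjn]
  | some q =>
    obtain ⟨hq1, hq2⟩ := head_le hD.1 hq
    obtain ⟨-, h1, h2, -⟩ := hD.2 q hq1
    obtain ⟨hs1, hs2⟩ := hs q hq1
    simp only [upperT, Option.elim]
    split_ifs with hqj
    · simp only [Option.mem_some_iff, forall_eq']
      rw [hqj, sideForm_succ_pos_iff hZ hn hj hjn] at h2
      rw [sideForm_succ_pos_iff hZ hn hj hjn]
      exact ⟨fun h => ⟨fun b hb => h.trans_le (hq2 b hb).1, fun r hr => h.trans (h2 r hr)⟩,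
        fun h => h.1 q hq1⟩
    · rw [← sideForm_succ_pos_iff hZ hn hj hjn]
      refine ⟨fun h => ⟨fun b hb => ?_, h⟩, fun h => h.2⟩
      rw [sideForm_pos_iff hZ hn (by omega) (by omega)] at h
      rw [sideForm_neg_iff hZ hn (by omega) (by omega)] at h1
      have h3 := tWall_le hZ hn (show 3 ≤ e.j + 1 by omega) (show e.j + 1 ≤ q.j by omega) (by omega)
      exact (h.trans_le h3).trans (h1.trans_le (hq2 b hb).1)

theorem lowerX_lt_iff (hD : InCell n Z D₂) :
    D₂.head?.elim 0 Entry.x < e.x ↔ (∀ b ∈ D₂, b.x < e.x) ∧ 0 < e.x := by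
  cases hq : D₂.head? with
  | none =>
    rw [List.head?_eq_none_iff] at hq
    simp [hq]
  | some q =>
    obtain ⟨hq1, hq2⟩ := head_le hD.1 hq
    have h1 := (hD.2 q hq1).1
    simp only [Option.elim]
    exact ⟨fun h => ⟨fun b hb => (hq2 b hb).2.trans_lt h, h1.trans h⟩, fun h => h.1 q hq1⟩

theorem lt_upperX_iff (hD : InCell n Z D₁) :
    (∀ h ∈ D₁.getLast?.map Entry.x, e.x < h) ↔ ∀ a ∈ D₁, e.x < a.x := by
  cases hp : D₁.getLast? with
  | none =>
    rw [List.getLast?_eq_none_iff] at hp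
    simp [hp]
  | some p =>
    obtain ⟨hp1, hp2⟩ := le_getLast hD.1 hp
    simp only [Option.map_some, Option.mem_some_iff, forall_eq']
    exact ⟨fun h a ha => h.trans_le (hp2 a ha).2, fun h => h p hp1⟩

theorem InCell.left (h : InCell n Z (D₁ ++ D₂)) : InCell n Z D₁ :=
  ⟨(List.pairwise_append.1 h.1).1, fun a ha => h.2 a (List.mem_append_left _ ha)⟩

theorem InCell.right (h : InCell n Z (D₁ ++ D₂)) : InCell n Z D₂ :=
  ⟨(List.pairwise_append.1 h.1).2.1, fun a ha => h.2 a (List.mem_append_right _ ha)⟩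

/-- The conditions on the inserted loop separate into one for `σ`, one interval for `t` and one for
`x`, with ends depending only on its neighbours. This is the fibration of a cell over the cell with
that loop deleted. -/
theorem inCell_insert (hZ : IsMHVData n Z) (hn : 4 ≤ n)
    (h₁ : ∀ a ∈ D₁, 3 ≤ a.j ∧ a.j ≤ e.j) (h₂ : ∀ b ∈ D₂, b.j + 1 ≤ n ∧ e.j ≤ b.j)
    (hj : 3 ≤ e.j) (hjn : e.j + 1 ≤ n) :
    InCell n Z (D₁ ++ e :: D₂) ↔ sWall n Z e.j e.t e.x < e.s ∧
      (lowerT n Z D₁.getLast? e.j < e.t ∧ ∀ h ∈ upperT n Z D₂.head? e.j, e.t < h) ∧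
      (D₂.head?.elim 0 Entry.x < e.x ∧ ∀ h ∈ D₁.getLast?.map Entry.x, e.x < h) ∧
      InCell n Z (D₁ ++ D₂) := by
  by_cases h : InCell n Z (D₁ ++ D₂)
  · rw [lowerT_lt_iff hZ hn h.left h₁ hj hjn, lt_upperT_iff hZ hn h.right h₂ hj hjn,
      lowerX_lt_iff h.right, lt_upperX_iff h.left]
    rw [InCell, pairwise_insert]
    constructor
    · rintro ⟨⟨-, h3, h4⟩, h5⟩
      obtain ⟨h6, h7, h8, h9⟩ := h5 e (by simp)
      exact ⟨h9, ⟨⟨fun a ha => (h3 a ha).1, h7⟩, fun b hb => (h4 b hb).1, h8⟩,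
        ⟨⟨fun b hb => (h4 b hb).2, h6⟩, fun a ha => (h3 a ha).2⟩, h⟩
    · rintro ⟨h9, ⟨⟨h3, h7⟩, h4, h8⟩, ⟨⟨h5, h6⟩, h10⟩, -⟩
      refine ⟨⟨h.1, fun a ha => ⟨h3 a ha, h10 a ha⟩, fun b hb => ⟨h4 b hb, h5 b hb⟩⟩,
        fun a ha => ?_⟩
      rcases List.mem_append.1 ha with ha | ha
      · exact h.2 a (List.mem_append_left _ ha)
      · rcases List.mem_cons.1 ha with rfl | ha
        · exact ⟨h6, h7, h8, h9⟩
        · exact h.2 a (List.mem_append_right _ ha)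
  · refine iff_of_false (fun h' => h ?_) fun h' => h h'.2.2.2
    refine ⟨(pairwise_insert.1 h'.1).1, fun a ha => h'.2 a ?_⟩
    rcases List.mem_append.1 ha with ha | ha
    · exact List.mem_append_left _ ha
    · exact List.mem_append_right _ (List.mem_cons_of_mem _ ha)

/-- The fibre in `t` is nonempty over every point of the smaller cell, so the difference of two rays
in `IsCanonicalForm.interval` really is an interval there. -/
theorem lowerT_lt_upperT (hZ : IsMHVData n Z) (hn : 4 ≤ n) (hD : InCell n Z (D₁ ++ D₂)) {j : ℕ}
    (h₁ : ∀ a ∈ D₁, 3 ≤ a.j ∧ a.j ≤ j) (hj : 3 ≤ j) (hjn : j + 1 ≤ n) :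
    ∀ h ∈ upperT n Z D₂.head? j, lowerT n Z D₁.getLast? j < h := by
  -- The entry fed in is fictitious; its `σ` and `x` play no role in the comparison of `t`.
  have hlow : ∀ t, (∀ a ∈ D₁, a.t < t) → sideForm n Z j t < 0 → lowerT n Z D₁.getLast? j < t :=
    fun t h3 h4 => (lowerT_lt_iff (e := ⟨0, t, 0, j⟩) hZ hn hD.left h₁ hj hjn).2 ⟨h3, h4⟩
  have hwall : ∀ h ∈ upperWall n Z j, lowerT n Z D₁.getLast? j < h := by
    intro h hh
    rw [upperWall] at hh
    split_ifs at hh with hlt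
    · obtain rfl : tWall n Z (j + 1) = h := by simpa using hh
      refine hlow _ (fun a ha => ?_) ?_
      · obtain ⟨-, -, h2, -⟩ := hD.left.2 a ha
        obtain ⟨h3, h4⟩ := h₁ a ha
        rw [sideForm_pos_iff hZ hn (by omega) (by omega)] at h2
        exact h2.trans_le (tWall_le hZ hn (by omega) (by omega) hlt)
      · rw [sideForm_neg_iff hZ hn hj hjn]
        exact tWall_lt hZ hn hj (Nat.lt_succ_self j) hlt
    · simp at hh
  cases hq : D₂.head? with
  | none => simpa [upperT] using hwall
  | some q =>
    obtain ⟨hq1, -⟩ := head_le hD.right.1 hq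
    simp only [upperT, Option.elim]
    split_ifs with hqj
    · simp only [Option.mem_some_iff, forall_eq']
      refine hlow _ (fun a ha => ((List.pairwise_append.1 hD.1).2.2 a ha q hq1).1) ?_
      rw [← hqj]
      exact (hD.right.2 q hq1).2.1
    · exact hwall

theorem lowerX_lt_upperX (hD : InCell n Z (D₁ ++ D₂)) :
    ∀ h ∈ D₁.getLast?.map Entry.x, D₂.head?.elim 0 Entry.x < h := by
  cases hp : D₁.getLast? with
  | none => simp
  | some p =>
    obtain ⟨hp1, -⟩ := le_getLast hD.left.1 hp
    simp only [Option.map_some, Option.mem_some_iff, forall_eq']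
    cases hq : D₂.head? with
    | none => exact (hD.left.2 p hp1).1
    | some q =>
      obtain ⟨hq1, -⟩ := head_le hD.right.1 hq
      exact ((List.pairwise_append.1 hD.1).2.2 p hp1 q hq1).2

/-- The list is reversed because `x` decreases along it: the next entry gives the lower end and the
previous one the upper. The links telescope by `1/((e-q)(p-e)) = (1/(p-q)) (1/(e-q) - 1/(e-p))`. -/
theorem linkProd_linkX_insert (hx₁ : ∀ a ∈ D₁, e.x ≠ a.x) (hx₂ : ∀ b ∈ D₂, e.x ≠ b.x)
    (hx : e.x ≠ 0) (hx' : ∀ a ∈ D₁, a.x ≠ 0) (hx₁₂ : ∀ a ∈ D₁, ∀ b ∈ D₂, a.x ≠ b.x) :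
    linkProd linkX none (D₁ ++ e :: D₂).reverse = linkProd linkX none (D₁ ++ D₂).reverse *
      (1 / (e.x - D₂.head?.elim 0 Entry.x) -
        (D₁.getLast?.map Entry.x).elim 0 fun h => 1 / (e.x - h)) := by
  rw [List.reverse_append, List.reverse_cons, List.append_assoc, List.singleton_append,
    List.reverse_append]
  apply linkProd_insert
  rw [List.getLast?_reverse, List.head?_reverse, Option.or_none]
  have hlo : e.x - D₂.head?.elim 0 Entry.x ≠ 0 := by
    cases hq : D₂.head? with
    | none => simpa using hx
    | some q => exact sub_ne_zero.2 (hx₂ q (List.mem_of_mem_head? hq))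
  cases hp : D₁.getLast? with
  | none => simp [linkX]
  | some p =>
    have hp1 : p ∈ D₁ := List.mem_of_getLast? hp
    have h1 := sub_ne_zero.2 (hx₁ p hp1)
    have h3 := sub_ne_zero.2 (hx₁ p hp1).symm
    have h2 : p.x - D₂.head?.elim 0 Entry.x ≠ 0 := by
      cases hq : D₂.head? with
      | none => simpa using hx' p hp1
      | some q => exact sub_ne_zero.2 (hx₁₂ p hp1 q (List.mem_of_mem_head? hq))
    simp only [linkX, Option.elim, Option.map_some]
    simp only [Option.elim] at hlo h2
    field_simp
    ring

/-- Partial fractions: `linkT` combines the pole at the lower end with the pole at the right wall of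
the interval. In the last interval `sideForm` is constant and the second pole is absent. -/
theorem linkT_eq (hZ : IsMHVData n Z) (hn : 4 ≤ n) (p : Option Entry)
    (hj : 3 ≤ e.j) (hjn : e.j + 1 ≤ n) (hlo : e.t ≠ lowerT n Z p e.j)
    (h0 : sideForm n Z (e.j + 1) e.t ≠ 0) :
    linkT n Z p e = 1 / (e.t - lowerT n Z p e.j) -
      (upperWall n Z e.j).elim 0 fun h => 1 / (e.t - h) := by
  have h1 := sub_ne_zero.2 hlo
  rw [linkT, upperWall]
  split_ifs with h
  · have h2 := (hZ.twoBracket_pos hn (show 3 ≤ e.j + 1 by omega) h le_rfl).ne'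
    have h3 : e.t - tWall n Z (e.j + 1) =
        -sideForm n Z (e.j + 1) e.t / twoBracket Z (e.j + 1) n := by
      rw [sideForm, tWall]
      field_simp
      ring
    have h4 : sideForm n Z (e.j + 1) (lowerT n Z p e.j) = sideForm n Z (e.j + 1) e.t +
        (e.t - lowerT n Z p e.j) * twoBracket Z (e.j + 1) n := by
      simp only [sideForm]; ring
    simp only [Option.elim]
    rw [h3, h4]
    field_simp
    ring
  · have h2 : e.j + 1 = n := by omega
    rw [h2, sideForm_last, sideForm_last]
    have h3 := (hZ.twoBracket_pos hn le_rfl (show 3 < n by omega) le_rfl).ne'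
    simp only [Option.elim]
    field_simp
    ring

/-- If the next entry lies in the same interval, the factors `sideForm` of `e` cancel and the two
links telescope. Otherwise the link of the next entry starts at its own left wall, whether preceded
by `e` or by an entry before `e`, and only the new link is added. -/
theorem linkProd_linkT_insert (hZ : IsMHVData n Z) (hn : 4 ≤ n)
    (h₁ : ∀ a ∈ D₁, a.j ≤ e.j) (h₂ : ∀ b ∈ D₂, e.j ≤ b.j)
    (hj : 3 ≤ e.j) (hjn : e.j + 1 ≤ n)
    (ht₁ : ∀ a ∈ D₁, e.t ≠ a.t) (ht₂ : ∀ b ∈ D₂, e.t ≠ b.t)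
    (ht₁₂ : ∀ a ∈ D₁, ∀ b ∈ D₂, a.t ≠ b.t)
    (hq : ∀ i, 3 ≤ i → i ≤ n → sideForm n Z i e.t ≠ 0)
    (hq₂ : ∀ b ∈ D₂, ∀ i, 3 ≤ i → i ≤ n → sideForm n Z i b.t ≠ 0) :
    linkProd (linkT n Z) none (D₁ ++ e :: D₂) = linkProd (linkT n Z) none (D₁ ++ D₂) *
      (1 / (e.t - lowerT n Z D₁.getLast? e.j) -
        (upperT n Z D₂.head? e.j).elim 0 fun h => 1 / (e.t - h)) := by
  apply linkProd_insert
  rw [Option.or_none]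
  have hwall : ∀ t, sideForm n Z e.j t ≠ 0 → t ≠ tWall n Z e.j := fun t ht h =>
    ht (h ▸ sideForm_tWall hZ hn hj hjn)
  have hlow : ∀ t, (∀ a ∈ D₁, t ≠ a.t) → sideForm n Z e.j t ≠ 0 →
      t ≠ lowerT n Z D₁.getLast? e.j := by
    intro t h3 h4
    cases hp : D₁.getLast? with
    | none => exact hwall t h4
    | some p =>
      simp only [lowerT, Option.elim]
      split_ifs
      · exact h3 p (List.mem_of_getLast? hp)
      · exact hwall t h4
  have hlo := hlow e.t ht₁ (hq _ hj (by omega))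
  have h0 := hq (e.j + 1) (by omega) hjn
  cases hh : D₂.head? with
  | none => simpa [upperT] using linkT_eq hZ hn _ hj hjn hlo h0
  | some q =>
    have hq1 : q ∈ D₂ := List.mem_of_mem_head? hh
    by_cases hqj : q.j = e.j
    · have h1 := sub_ne_zero.2 hlo
      have h2 := sub_ne_zero.2 (ht₂ q hq1)
      have h2' := sub_ne_zero.2 (ht₂ q hq1).symm
      have h3 := sub_ne_zero.2
        (hlow q.t (fun a ha => (ht₁₂ a ha q hq1).symm) (hq₂ q hq1 _ hj (by omega)))
      have h4 := hq₂ q hq1 (e.j + 1) (by omega) hjn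
      have h5 : lowerT n Z (some e) q.j = e.t := by simp [lowerT, hqj]
      simp only [Option.elim, upperT, if_pos hqj]
      rw [linkT, linkT, linkT, h5, hqj]
      field_simp
      ring
    · have h1 : lowerT n Z (some e) q.j = tWall n Z q.j := by simp [lowerT, Ne.symm hqj]
      have h2 : lowerT n Z D₁.getLast? q.j = tWall n Z q.j := by
        cases hp : D₁.getLast? with
        | none => rfl
        | some p =>
          have := h₁ p (List.mem_of_getLast? hp)
          have := h₂ q hq1
          simp only [lowerT, Option.elim]
          rw [if_neg (by omega)]
      have h3 : linkT n Z (some e) q = linkT n Z D₁.getLast? q := by rw [linkT, linkT, h1, h2]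
      simp only [Option.elim, upperT, if_neg hqj]
      rw [h3, mul_comm, linkT_eq hZ hn _ hj hjn hlo h0]
      rfl

end Insert

/-! ### General position -/

/-- No two loops share a coordinate, and no loop lies on a wall. -/
structure InGeneralPosition (n : ℕ) (Z : ℕ → Twistor) {L : ℕ} (u : Fin (3 * L) → ℝ) : Prop where
  x_ne : ∀ α, xCoord u α ≠ 0
  side_ne : ∀ α i, 3 ≤ i → i ≤ n → sideForm n Z i (tCoord u α) ≠ 0
  s_ne : ∀ α i, 3 ≤ i → i + 1 ≤ n → sCoord u α ≠ sWall n Z i (tCoord u α) (xCoord u α)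
  x_ne_x : ∀ α β, α ≠ β → xCoord u α ≠ xCoord u β
  t_ne_t : ∀ α β, α ≠ β → tCoord u α ≠ tCoord u β

theorem InGeneralPosition.t_ne {L : ℕ} {u : Fin (3 * L) → ℝ} (h : InGeneralPosition n Z u)
    (hn : 4 ≤ n) (α : Fin L) : tCoord u α ≠ 0 := fun h0 =>
  h.side_ne α 3 le_rfl (by omega) (by rw [sideForm_three, h0, zero_mul, neg_zero])

theorem isPoly_sCoord {L : ℕ} (α : Fin L) : IsPoly fun u : Fin (3 * L) → ℝ => sCoord u α :=
  IsPoly.coord _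

theorem isPoly_tCoord {L : ℕ} (α : Fin L) : IsPoly fun u : Fin (3 * L) → ℝ => tCoord u α :=
  IsPoly.coord _

theorem isPoly_xCoord {L : ℕ} (α : Fin L) : IsPoly fun u : Fin (3 * L) → ℝ => xCoord u α :=
  IsPoly.coord _

/-- The point with prescribed coordinates `σ`, `t` and `x` of the loops. -/
def ofCoords {L : ℕ} (s t x : Fin L → ℝ) (i : Fin (3 * L)) : ℝ :=
  ![s, t, x] ⟨i % 3, Nat.mod_lt _ (by omega)⟩ ⟨i / 3, by omega⟩

theorem sCoord_ofCoords {L : ℕ} (s t x : Fin L → ℝ) (α : Fin L) :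
    sCoord (ofCoords s t x) α = s α := by
  have h1 : (⟨(3 * (α : ℕ)) % 3, Nat.mod_lt _ (by omega)⟩ : Fin 3) = 0 := Fin.ext (by simp)
  have h2 : (⟨(3 * (α : ℕ)) / 3, by omega⟩ : Fin L) = α := Fin.ext (by simp)
  simp only [sCoord, ofCoords, h1, h2]
  rfl

theorem tCoord_ofCoords {L : ℕ} (s t x : Fin L → ℝ) (α : Fin L) :
    tCoord (ofCoords s t x) α = t α := by
  have h1 : (⟨(3 * (α : ℕ) + 1) % 3, Nat.mod_lt _ (by omega)⟩ : Fin 3) = 1 :=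
    Fin.ext (by simp)
  have h2 : (⟨(3 * (α : ℕ) + 1) / 3, by omega⟩ : Fin L) = α := Fin.ext (by simp; omega)
  simp only [tCoord, ofCoords, h1, h2]
  rfl

theorem xCoord_ofCoords {L : ℕ} (s t x : Fin L → ℝ) (α : Fin L) :
    xCoord (ofCoords s t x) α = x α := by
  have h1 : (⟨(3 * (α : ℕ) + 2) % 3, Nat.mod_lt _ (by omega)⟩ : Fin 3) = 2 :=
    Fin.ext (by simp)
  have h2 : (⟨(3 * (α : ℕ) + 2) / 3, by omega⟩ : Fin L) = α := Fin.ext (by simp; omega)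
  simp only [xCoord, ofCoords, h1, h2]
  rfl

theorem isPoly_cut_edge {d : ℕ} {t x : (Fin d → ℝ) → ℝ} (ht : IsPoly t) (hx : IsPoly x) (i : ℕ) :
    IsPoly fun u => bracket (pointA Z (x u)) (pointB n Z 0 (t u)) (Z i) (Z (i + 1)) := by
  have h : ∀ t x : ℝ, bracket (pointA Z x) (pointB n Z 0 t) (Z i) (Z (i + 1)) =
      bracket (Z 1) (Z 3) (Z i) (Z (i + 1)) + t * bracket (Z 1) (Z n) (Z i) (Z (i + 1)) +
        x * (bracket (Z 2) (Z 3) (Z i) (Z (i + 1)) +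
          t * bracket (Z 2) (Z n) (Z i) (Z (i + 1))) := by
    intro t x
    simp only [bracket_eq, pointA, pointB, Pi.add_apply, Pi.sub_apply, Pi.smul_apply, smul_eq_mul]
    ring
  simp only [h]
  exact ((IsPoly.const _).add (ht.mul (IsPoly.const _))).add
    (hx.mul ((IsPoly.const _).add (ht.mul (IsPoly.const _))))

theorem isPoly_sideForm {d : ℕ} {t : (Fin d → ℝ) → ℝ} (ht : IsPoly t) (i : ℕ) :
    IsPoly fun u => sideForm n Z i (t u) :=
  (IsPoly.const _).sub (ht.mul (IsPoly.const _))

theorem isRational_sWall {d : ℕ} {t x : (Fin d → ℝ) → ℝ} (ht : IsPoly t) (hx : IsPoly x)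
    (hx0 : ∃ u, x u ≠ 0) {i : ℕ} (hi : twoBracket Z i (i + 1) ≠ 0) :
    IsRational fun u => sWall n Z i (t u) (x u) :=
  (isPoly_cut_edge ht hx i).neg.isRational_div (hx.mul (IsPoly.const _))
    (hx0.imp fun _ hu => mul_ne_zero hu hi)

theorem generic_inGeneralPosition (hZ : IsMHVData n Z) (hn : 4 ≤ n) (L : ℕ) :
    Generic fun u : Fin (3 * L) → ℝ => InGeneralPosition n Z u := by
  have hx : ∀ α : Fin L, ∃ u : Fin (3 * L) → ℝ, xCoord u α ≠ 0 := fun α =>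
    ⟨fun _ => 1, one_ne_zero⟩
  have h1 : Generic fun u : Fin (3 * L) → ℝ => ∀ α, xCoord u α ≠ 0 :=
    Generic.fintype_forall fun α => (isPoly_xCoord α).generic_ne (hx α)
  have h2 : Generic fun u : Fin (3 * L) → ℝ => ∀ α, ∀ i ∈ Finset.Icc 3 n,
      sideForm n Z i (tCoord u α) ≠ 0 := by
    refine Generic.fintype_forall fun α => Generic.finset_forall _ fun i hi => ?_
    rw [Finset.mem_Icc] at hi
    -- At `t = -1` all side forms are positive.
    exact (isPoly_sideForm (isPoly_tCoord α) i).generic_ne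
      ⟨fun _ => -1, (sideForm_pos_of_neg hZ hn neg_one_lt_zero hi.1 hi.2).ne'⟩
  have h3 : Generic fun u : Fin (3 * L) → ℝ => ∀ α, ∀ i ∈ Finset.Ico 3 n,
      sCoord u α ≠ sWall n Z i (tCoord u α) (xCoord u α) := by
    refine Generic.fintype_forall fun α => Generic.finset_forall _ fun i hi => ?_
    rw [Finset.mem_Ico] at hi
    have hg := (hZ.twoBracket_pos hn hi.1 (Nat.lt_succ_self i) hi.2).ne'
    refine ((isPoly_sCoord α).isRational.generic_eq_or_ne
      (isRational_sWall (isPoly_tCoord α) (isPoly_xCoord α) (hx α) hg)).resolve_left fun h => ?_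
    -- If `σ` were generically on the wall, the polynomial `⟨ABii+1⟩` would vanish generically; but
    -- it is nonzero one unit above the wall at `t = x = 1`.
    have hpoly : IsPoly fun u : Fin (3 * L) → ℝ =>
        bracket (pointA Z (xCoord u α)) (pointB n Z (sCoord u α) (tCoord u α))
          (Z i) (Z (i + 1)) := by
      refine Eq.mp (congrArg IsPoly (funext fun u => (bracket_cut_edge_add _ _ _ _).symm)) ?_
      exact (((isPoly_sCoord α).mul (isPoly_xCoord α)).mul (IsPoly.const _)).add
        (isPoly_cut_edge (isPoly_tCoord α) (isPoly_xCoord α) i)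
    have hne := hpoly.generic_ne ⟨ofCoords (fun _ => sWall n Z i 1 1 + 1) (fun _ => 1)
      (fun _ => 1), by
        rw [sCoord_ofCoords, tCoord_ofCoords, xCoord_ofCoords,
          bracket_cut_edge _ _ one_ne_zero hg]
        simpa using hg⟩
    obtain ⟨u, hu⟩ := ((h.and h1).and hne).exists_point
    refine hu.2 ?_
    rw [bracket_cut_edge _ _ (hu.1.2 α) hg, hu.1.1, sub_self, mul_zero]
  have h4 : Generic fun u : Fin (3 * L) → ℝ => ∀ α β, α ≠ β → xCoord u α - xCoord u β ≠ 0 := by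
    refine Generic.fintype_forall fun α => Generic.fintype_forall fun β => ?_
    by_cases h : α = β
    · exact Generic.of_forall fun _ h' => absurd h h'
    · refine (((isPoly_xCoord α).sub (isPoly_xCoord β)).generic_ne ⟨ofCoords 0 0
        (Pi.single α 1), ?_⟩).mono fun u hu _ => hu
      rw [xCoord_ofCoords, xCoord_ofCoords, Pi.single_eq_same, Pi.single_eq_of_ne (Ne.symm h)]
      norm_num
  have h5 : Generic fun u : Fin (3 * L) → ℝ => ∀ α β, α ≠ β → tCoord u α - tCoord u β ≠ 0 := by
    refine Generic.fintype_forall fun α => Generic.fintype_forall fun β => ?_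
    by_cases h : α = β
    · exact Generic.of_forall fun _ h' => absurd h h'
    · refine (((isPoly_tCoord α).sub (isPoly_tCoord β)).generic_ne ⟨ofCoords 0
        (Pi.single α 1) 0, ?_⟩).mono fun u hu _ => hu
      rw [tCoord_ofCoords, tCoord_ofCoords, Pi.single_eq_same, Pi.single_eq_of_ne (Ne.symm h)]
      norm_num
  refine ((h1.and h2).and (h3.and (h4.and h5))).mono fun u ⟨⟨a1, a2⟩, a3, a4, a5⟩ => ?_
  exact ⟨a1, fun α i hi hin => a2 α i (Finset.mem_Icc.2 ⟨hi, hin⟩),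
    fun α i hi hin => a3 α i (Finset.mem_Ico.2 ⟨hi, hin⟩),
    fun α β h => sub_ne_zero.1 (a4 α β h), fun α β h => sub_ne_zero.1 (a5 α β h)⟩

/-! ### The canonical form of a cell -/

/-- The entry of loop `a.1` with interval index `a.2`. -/
def entry {L : ℕ} (u : Fin (3 * L) → ℝ) (a : Fin L × ℕ) : Entry :=
  ⟨sCoord u a.1, tCoord u a.1, xCoord u a.1, a.2⟩

theorem exists_map_succ {L : ℕ} (l : List (Fin (L + 1) × ℕ)) (h : ∀ a ∈ l, a.1 ≠ 0) :
    ∃ l' : List (Fin L × ℕ), l = l'.map (Prod.map Fin.succ id) := by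
  induction l with
  | nil => exact ⟨[], rfl⟩
  | cons a l ih =>
    obtain ⟨l', rfl⟩ := ih fun b hb => h b (List.mem_cons_of_mem _ hb)
    obtain ⟨α, hα⟩ := Fin.exists_succ_eq.2 (h a List.mem_cons_self)
    exact ⟨(α, a.2) :: l', by simp [hα]⟩

theorem isRational_lowerT {L : ℕ} (a : Option (Fin L × ℕ)) (j : ℕ) :
    IsRational fun u : Fin (3 * L) → ℝ => lowerT n Z (a.map (entry u)) j := by
  cases a with
  | none => exact (IsPoly.const _).isRational
  | some a =>
    by_cases h : a.2 = j
    · simpa [lowerT, entry, h] using (isPoly_tCoord a.1).isRational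
    · simpa [lowerT, entry, h] using (IsPoly.const (tWall n Z j)).isRational

/-- Whether an upper end exists depends on the labels only, so the option can be taken outside the
dependence on the point, as `IsCanonicalForm.interval` requires. -/
theorem exists_upperT {L : ℕ} (a : Option (Fin L × ℕ)) (j : ℕ) :
    ∃ hi : Option ((Fin (3 * L) → ℝ) → ℝ), (∀ r ∈ hi, IsRational r) ∧
      ∀ u, upperT n Z (a.map (entry u)) j = hi.map fun r => r u := by
  have hwall : ∃ hi : Option ((Fin (3 * L) → ℝ) → ℝ), (∀ r ∈ hi, IsRational r) ∧
      ∀ u, upperWall n Z j = hi.map fun r => r u := by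
    refine ⟨(upperWall n Z j).map fun c _ => c, fun r hr => ?_, fun u => ?_⟩
    · obtain ⟨c, -, rfl⟩ := Option.map_eq_some_iff.1 hr
      exact (IsPoly.const c).isRational
    · cases upperWall n Z j <;> rfl
  cases a with
  | none => exact hwall
  | some a =>
    by_cases h : a.2 = j
    · refine ⟨some fun u => tCoord u a.1, fun r hr => ?_, fun u => by simp [upperT, entry, h]⟩
      obtain rfl := Option.some.inj hr
      exact (isPoly_tCoord a.1).isRational
    · simpa [upperT, entry, h] using hwall

theorem isRational_lowerX {L : ℕ} (a : Option (Fin L × ℕ)) :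
    IsRational fun u : Fin (3 * L) → ℝ => (a.map (entry u)).elim 0 Entry.x := by
  cases a with
  | none => exact (IsPoly.const _).isRational
  | some a => exact (isPoly_xCoord a.1).isRational

theorem exists_upperX {L : ℕ} (a : Option (Fin L × ℕ)) :
    ∃ hi : Option ((Fin (3 * L) → ℝ) → ℝ), (∀ r ∈ hi, IsRational r) ∧
      ∀ u, (a.map (entry u)).map Entry.x = hi.map fun r => r u := by
  cases a with
  | none => exact ⟨none, by simp, by simp⟩
  | some a =>
    refine ⟨some fun u => xCoord u a.1, fun r hr => ?_, fun u => rfl⟩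
    obtain rfl := Option.some.inj hr
    exact (isPoly_xCoord a.1).isRational

theorem cellForm_insert {D₁ D₂ : List Entry} {e : Entry} (hZ : IsMHVData n Z) (hn : 4 ≤ n)
    (h₁ : ∀ a ∈ D₁, a.j ≤ e.j) (h₂ : ∀ b ∈ D₂, e.j ≤ b.j)
    (hj : 3 ≤ e.j) (hjn : e.j + 1 ≤ n)
    (ht₁ : ∀ a ∈ D₁, e.t ≠ a.t) (ht₂ : ∀ b ∈ D₂, e.t ≠ b.t)
    (ht₁₂ : ∀ a ∈ D₁, ∀ b ∈ D₂, a.t ≠ b.t)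
    (hq : ∀ i, 3 ≤ i → i ≤ n → sideForm n Z i e.t ≠ 0)
    (hq₂ : ∀ b ∈ D₂, ∀ i, 3 ≤ i → i ≤ n → sideForm n Z i b.t ≠ 0)
    (hx₁ : ∀ a ∈ D₁, e.x ≠ a.x) (hx₂ : ∀ b ∈ D₂, e.x ≠ b.x)
    (hx : e.x ≠ 0) (hx' : ∀ a ∈ D₁, a.x ≠ 0) (hx₁₂ : ∀ a ∈ D₁, ∀ b ∈ D₂, a.x ≠ b.x) :
    cellForm n Z (D₁ ++ e :: D₂) = cellForm n Z (D₁ ++ D₂) *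
      (1 / (e.x - D₂.head?.elim 0 Entry.x) -
        (D₁.getLast?.map Entry.x).elim 0 fun h => 1 / (e.x - h)) *
      (1 / (e.t - lowerT n Z D₁.getLast? e.j) -
        (upperT n Z D₂.head? e.j).elim 0 fun h => 1 / (e.t - h)) /
      (e.s - sWall n Z e.j e.t e.x) := by
  rw [cellForm, cellForm, linkProd_linkX_insert hx₁ hx₂ hx hx' hx₁₂,
    linkProd_linkT_insert hZ hn h₁ h₂ hj hjn ht₁ ht₂ ht₁₂ hq hq₂]
  simp only [List.map_append, List.map_cons, List.prod_append, List.prod_cons]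
  ring

open Classical in
-- Induction on the number of loops. The first three coordinates belong to loop `0`, which may stand
-- anywhere in the ordered list; it is removed, and the cell is rebuilt over the remaining loops by
-- an interval in `x`, an interval in `t` and a ray in `σ`.
theorem isCanonicalForm_cell (hZ : IsMHVData n Z) (hn : 4 ≤ n) : ∀ (L : ℕ)
    (l : List (Fin L × ℕ)), (l.map Prod.fst).Nodup → l.length = L →
    l.Pairwise (fun a b => a.2 ≤ b.2) → (∀ a ∈ l, 3 ≤ a.2 ∧ a.2 + 1 ≤ n) →
    IsCanonicalForm (3 * L) (fun u => if InCell n Z (l.map (entry u)) then 1 else 0)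
      fun u => cellForm n Z (l.map (entry u))
  | 0, l, _, hlen, _, _ => fun u => by
    obtain rfl := List.eq_nil_of_length_eq_zero hlen
    simp [InCell, cellForm, linkProd]
  | L + 1, l, hnd, hlen, hs, hj => by
    have h0 : (0 : Fin (L + 1)) ∈ l.map Prod.fst := by
      have : (l.map Prod.fst).toFinset = Finset.univ := by
        apply Finset.eq_univ_of_card
        rw [List.toFinset_card_of_nodup hnd, List.length_map, hlen, Fintype.card_fin]
      rw [← List.mem_toFinset, this]
      exact Finset.mem_univ _
    obtain ⟨⟨α, j⟩, hmem, rfl : α = 0⟩ := List.mem_map.1 h0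
    obtain ⟨k₁, k₂, rfl⟩ := List.append_of_mem hmem
    have hnd' : ((k₁ ++ k₂).map Prod.fst).Nodup ∧ (∀ a ∈ k₁, a.1 ≠ 0) ∧ ∀ a ∈ k₂, a.1 ≠ 0 := by
      rw [List.Nodup, List.pairwise_map, pairwise_insert] at hnd
      rw [List.Nodup, List.pairwise_map]
      exact ⟨hnd.1, hnd.2.1, fun a ha => (hnd.2.2 a ha).symm⟩
    obtain ⟨l₁, rfl⟩ := exists_map_succ k₁ hnd'.2.1
    obtain ⟨l₂, rfl⟩ := exists_map_succ k₂ hnd'.2.2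
    rw [pairwise_insert] at hs
    obtain ⟨hs, hs₁, hs₂⟩ := hs
    have hj' := hj (0, j) (by simp)
    rw [← List.map_append] at hnd' hs
    have hnd'' : ((l₁ ++ l₂).map Prod.fst).Nodup := by
      have := hnd'.1
      rw [List.map_map] at this
      rw [show Prod.fst ∘ Prod.map (Fin.succ (n := L)) (id : ℕ → ℕ) = Fin.succ ∘ Prod.fst from rfl,
        ← List.map_map] at this
      exact this.of_map _
    have ih := isCanonicalForm_cell hZ hn L (l₁ ++ l₂) hnd''
      (by simpa [← add_assoc] using hlen) (by rw [List.pairwise_map] at hs; exact hs)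
      fun a ha => hj (Prod.map Fin.succ id a) (by
        rcases List.mem_append.1 ha with h | h
        · exact List.mem_append_left _ (List.mem_map_of_mem h)
        · exact List.mem_append_right _ (List.mem_cons_of_mem _ (List.mem_map_of_mem h)))
    have hb₁ : ∀ (u : Fin (3 * L) → ℝ), ∀ a ∈ l₁.map (entry u), 3 ≤ a.j ∧ a.j ≤ j := by
      intro u a ha
      obtain ⟨b, hb, rfl⟩ := List.mem_map.1 ha
      have hb' := List.mem_map_of_mem (f := Prod.map Fin.succ id) hb
      exact ⟨(hj _ (List.mem_append_left _ hb')).1, hs₁ _ hb'⟩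
    have hb₂ : ∀ (u : Fin (3 * L) → ℝ), ∀ a ∈ l₂.map (entry u), a.j + 1 ≤ n ∧ j ≤ a.j := by
      intro u a ha
      obtain ⟨b, hb, rfl⟩ := List.mem_map.1 ha
      have hb' := List.mem_map_of_mem (f := Prod.map Fin.succ id) hb
      exact ⟨(hj _ (List.mem_append_right _ (List.mem_cons_of_mem _ hb'))).2, hs₂ _ hb'⟩
    obtain ⟨hiT, hiT1, hiT2⟩ := exists_upperT (n := n) (Z := Z) l₂.head? j
    obtain ⟨hiX, hiX1, hiX2⟩ := exists_upperX l₁.getLast?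
    have hX := ih.interval (isRational_lowerX l₂.head?) hiX hiX1 (by
      -- Nonzero weight means that the other loops form a cell, over which the interval in `x` has
      -- its ends in order.
      intro r hr u hu
      have hc : InCell n Z ((l₁ ++ l₂).map (entry u)) := by
        by_contra hc
        exact hu (if_neg hc)
      rw [List.map_append] at hc
      have := lowerX_lt_upperX hc (r u) (by
        rw [List.getLast?_map, hiX2]
        exact Option.mem_map_of_mem (fun r => r u) hr)
      rwa [List.head?_map] at this)
    have hT := hX.interval (isRational_lowerT (n := n) (Z := Z) l₁.getLast? j).tail
      (hiT.map fun r v => r (Fin.tail v)) (by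
        intro r hr
        obtain ⟨r', hr', rfl⟩ := Option.map_eq_some_iff.1 hr
        exact (hiT1 r' hr').tail) (by
      intro r hr v hv
      obtain ⟨r', hr', rfl⟩ := Option.map_eq_some_iff.1 hr
      have hc : InCell n Z ((l₁ ++ l₂).map (entry (Fin.tail v))) := by
        by_contra hc
        simp only [if_neg hc, ite_self] at hv
        exact hv rfl
      rw [List.map_append] at hc
      have := lowerT_lt_upperT hZ hn hc (hb₁ _) hj'.1 hj'.2 (r' (Fin.tail v)) (by
        rw [List.head?_map, hiT2]
        exact Option.mem_map_of_mem (fun r => r (Fin.tail v)) hr')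
      rwa [List.getLast?_map] at this)
    have hg := (hZ.twoBracket_pos hn hj'.1 (Nat.lt_succ_self j) hj'.2).ne'
    have hS := hT.ray (isRational_sWall (n := n) (Z := Z) (t := fun v => v 0)
      (x := fun v => Fin.tail v 0) (IsPoly.coord 0) (IsPoly.coord 0).tail
      ⟨fun _ => 1, one_ne_zero⟩ hg)
    have hlist : ∀ u : Fin (3 * L + 1 + 1 + 1) → ℝ,
        (l₁.map (Prod.map Fin.succ id) ++ (0, j) :: l₂.map (Prod.map Fin.succ id)).map
          (entry (L := L + 1) u) = l₁.map (entry (Fin.tail (Fin.tail (Fin.tail u)))) ++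
            ⟨u 0, Fin.tail u 0, Fin.tail (Fin.tail u) 0, j⟩ ::
              l₂.map (entry (Fin.tail (Fin.tail (Fin.tail u)))) := by
      intro u
      rw [List.map_append, List.map_cons, List.map_map, List.map_map]
      rfl
    have hmap : ∀ v : Fin (3 * L) → ℝ, (l₁ ++ l₂).map (entry v) =
        l₁.map (entry v) ++ l₂.map (entry v) := fun v => List.map_append
    -- The weights agree everywhere by `inCell_insert`; the forms agree in general position, where
    -- the denominators in `cellForm_insert` do not vanish.
    refine hS.congr (Generic.of_forall fun u => ?_)
      ((generic_inGeneralPosition hZ hn (L + 1)).mono fun u hu => ?_)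
    · rw [hlist u, if_congr (inCell_insert hZ hn (hb₁ _) (hb₂ _) hj'.1 hj'.2) rfl rfl,
        List.getLast?_map, List.head?_map, hiT2, hiX2, hmap]
      simp only [ite_and]
      refine if_congr Iff.rfl (if_congr Iff.rfl (if_congr ?_ (if_congr Iff.rfl
        (if_congr ?_ rfl rfl) rfl) rfl) rfl) rfl
      · cases hiT <;> simp
      · cases hiX <;> simp
    · set v : Fin (3 * L) → ℝ := Fin.tail (n := 3 * L)
        (Fin.tail (n := 3 * L + 1) (Fin.tail (n := 3 * L + 2) u)) with hv
      have hmem : ∀ l : List (Fin L × ℕ), ∀ a ∈ l.map (entry v), ∃ b ∈ l,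
          a.t = tCoord u b.1.succ ∧ a.x = xCoord u b.1.succ := by
        intro l a ha
        obtain ⟨b, hb, rfl⟩ := List.mem_map.1 ha
        exact ⟨b, hb, rfl, rfl⟩
      have hdis : ∀ a ∈ l₁, ∀ b ∈ l₂, a.1.succ ≠ b.1.succ := by
        rw [List.map_append, List.nodup_append] at hnd''
        exact fun a ha b hb h => hnd''.2.2 _ (List.mem_map_of_mem ha) _ (List.mem_map_of_mem hb)
          (Fin.succ_injective L h)
      have h1 := cellForm_insert (D₁ := l₁.map (entry v)) (D₂ := l₂.map (entry v))
        (e := ⟨sCoord u 0, tCoord u 0, xCoord u 0, j⟩) hZ hn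
        (fun a ha => (hb₁ v a ha).2) (fun a ha => (hb₂ v a ha).2) hj'.1 hj'.2
        (fun a ha => by
          obtain ⟨b, -, h, -⟩ := hmem _ a ha
          rw [h]
          exact hu.t_ne_t _ _ (Fin.succ_ne_zero _).symm)
        (fun a ha => by
          obtain ⟨b, -, h, -⟩ := hmem _ a ha
          rw [h]
          exact hu.t_ne_t _ _ (Fin.succ_ne_zero _).symm)
        (fun a ha b hb => by
          obtain ⟨a', ha', h, -⟩ := hmem _ a ha
          obtain ⟨b', hb', h', -⟩ := hmem _ b hb
          rw [h, h']
          exact hu.t_ne_t _ _ (hdis _ ha' _ hb'))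
        (hu.side_ne 0)
        (fun a ha => by
          obtain ⟨b, -, h, -⟩ := hmem _ a ha
          rw [h]
          exact hu.side_ne _)
        (fun a ha => by
          obtain ⟨b, -, -, h⟩ := hmem _ a ha
          rw [h]
          exact hu.x_ne_x _ _ (Fin.succ_ne_zero _).symm)
        (fun a ha => by
          obtain ⟨b, -, -, h⟩ := hmem _ a ha
          rw [h]
          exact hu.x_ne_x _ _ (Fin.succ_ne_zero _).symm)
        (hu.x_ne 0)
        (fun a ha => by
          obtain ⟨b, -, -, h⟩ := hmem _ a ha
          rw [h]
          exact hu.x_ne _)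
        (fun a ha b hb => by
          obtain ⟨a', ha', -, h⟩ := hmem _ a ha
          obtain ⟨b', hb', -, h'⟩ := hmem _ b hb
          rw [h, h']
          exact hu.x_ne_x _ _ (hdis _ ha' _ hb'))
      rw [hlist u]
      refine h1.trans ?_
      rw [List.getLast?_map, List.head?_map, hiT2, hiX2, hmap]
      congr 1
      congr 1
      · congr 1
        congr 1
        cases hiX <;> rfl
      · congr 1
        cases hiT <;> rfl

/-! ### Compositions and monotone maps -/

section Composition

variable {L : ℕ}

theorem blocksFun_eq_card (N : Composition L) (k : Fin N.length) :
    N.blocksFun k = (Finset.univ.filter fun i => N.index i = k).card := by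
  have h : Finset.univ.filter (fun i => N.index i = k) =
      Finset.univ.map (N.embedding k).toEmbedding := by
    ext i
    rw [Finset.mem_filter, Finset.mem_map, eq_comm, ← Composition.mem_range_embedding_iff']
    simp
  rw [h, Finset.card_map, Finset.card_univ, Fintype.card_fin]

theorem index_surjective (N : Composition L) : Function.Surjective N.index := fun k =>
  ⟨N.embedding k ⟨0, N.one_le_blocksFun k⟩, N.index_embedding k _⟩

theorem monotone_index (N : Composition L) : Monotone N.index := by
  intro a b hab
  by_contra! h
  have h1 := N.lt_sizeUpTo_index_succ b
  have h2 := N.sizeUpTo_index_le a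
  have h3 := N.monotone_sizeUpTo (show ((N.index b).succ : ℕ) ≤ N.index a from h)
  have h4 : (a : ℕ) ≤ b := hab
  omega

/-- The sizes of the fibres of a map, in the order of its values. -/
def fibreSizes (c : Fin L → ℕ) : List ℕ :=
  List.ofFn fun k : Fin (Finset.univ.image c).card =>
    (Finset.univ.filter fun i => c i = (Finset.univ.image c).orderEmbOfFin rfl k).card

/-- A strictly increasing `J` is the increasing enumeration of the values of `J ∘ N.index`, so the
blocks can be recovered from this map alone. -/
theorem blocks_eq_fibreSizes (N : Composition L) (J : Fin N.length → ℕ) (hJ : StrictMono J) :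
    N.blocks = fibreSizes fun i => J (N.index i) := by
  have himage : (Finset.univ.image fun i => J (N.index i)) = Finset.univ.image J := by
    ext y
    simp only [Finset.mem_image, Finset.mem_univ, true_and]
    exact ⟨fun ⟨i, hi⟩ => ⟨_, hi⟩, fun ⟨k, hk⟩ => by
      obtain ⟨i, rfl⟩ := index_surjective N k
      exact ⟨i, hk⟩⟩
  have hcard : (Finset.univ.image fun i => J (N.index i)).card = N.length := by
    rw [himage, Finset.card_image_of_injective _ hJ.injective, Finset.card_univ, Fintype.card_fin]
  have hemb := Finset.orderEmbOfFin_unique hcard (f := J)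
    (fun k => by rw [himage]; exact Finset.mem_image_of_mem _ (Finset.mem_univ k)) hJ
  rw [fibreSizes, ← N.ofFn_blocksFun, List.ofFn_congr hcard]
  congr 1
  ext k
  rw [blocksFun_eq_card]
  congr 1
  refine Finset.filter_congr fun i _ => ?_
  have : (Finset.univ.image fun i => J (N.index i)).orderEmbOfFin rfl (Fin.cast hcard.symm k) =
      J k := by
    exact (congrFun hemb k).symm
  rw [this]
  exact hJ.injective.eq_iff.symm

theorem composition_unique {N N' : Composition L} {J : Fin N.length → ℕ} {J' : Fin N'.length → ℕ}
    (hJ : StrictMono J) (hJ' : StrictMono J') (h : ∀ i, J (N.index i) = J' (N'.index i)) :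
    N = N' := by
  apply Composition.ext
  rw [blocks_eq_fibreSizes N J hJ, blocks_eq_fibreSizes N' J' hJ', funext h]

/-- The fibres of a monotone map are consecutive blocks: their sizes give the composition, the
increasing enumeration of the image gives `J`. -/
theorem exists_composition {c : Fin L → ℕ} (hc : Monotone c) :
    ∃ (N : Composition L) (J : Fin N.length → ℕ), StrictMono J ∧ ∀ i, J (N.index i) = c i := by
  set S := Finset.univ.image c with hS
  set J₀ := S.orderEmbOfFin rfl with hJ₀
  have hmem : ∀ i, ∃ k, J₀ k = c i := fun i => by
    have : c i ∈ Set.range J₀ := by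
      rw [hJ₀, Finset.range_orderEmbOfFin]
      exact Finset.mem_coe.2 (Finset.mem_image_of_mem c (Finset.mem_univ i))
    exact this
  have hsum : ∀ s : Finset (Fin S.card), ∑ k ∈ s, (Finset.univ.filter fun i => c i = J₀ k).card =
      (Finset.univ.filter fun i => ∃ k ∈ s, c i = J₀ k).card := by
    intro s
    rw [← Finset.card_biUnion]
    · congr 1
      ext i
      simp
    · intro k _ k' _ hkk
      rw [Function.onFun, Finset.disjoint_left]
      intro i hi hi'
      rw [Finset.mem_filter] at hi hi'
      exact hkk (J₀.injective (hi.2.symm.trans hi'.2))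
  let N : Composition L :=
    { blocks := fibreSizes c
      blocks_pos := by
        intro b hb
        obtain ⟨k, rfl⟩ := List.mem_ofFn.1 hb
        obtain ⟨i, -, hi⟩ := Finset.mem_image.1 (S.orderEmbOfFin_mem rfl k)
        exact Finset.card_pos.2 ⟨i, Finset.mem_filter.2 ⟨Finset.mem_univ _, hi⟩⟩
      blocks_sum := by
        rw [fibreSizes, List.sum_ofFn]
        refine (hsum Finset.univ).trans ?_
        rw [Finset.filter_true_of_mem, Finset.card_univ, Fintype.card_fin]
        intro i _
        obtain ⟨k, hk⟩ := hmem i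
        exact ⟨k, Finset.mem_univ k, hk.symm⟩ }
  have hlen : N.length = S.card := List.length_ofFn
  refine ⟨N, fun k => J₀ (Fin.cast hlen k), fun a b hab => J₀.strictMono hab, fun i => ?_⟩
  obtain ⟨k, hk⟩ := hmem i
  -- The partial sum of the first `m` blocks counts the positions whose value is among the `m`
  -- smallest. By monotonicity the block of `i` is then the one belonging to the value `c i`.
  have hsize : ∀ m, N.sizeUpTo m =
      (Finset.univ.filter fun i => ∃ k ∈ Finset.univ.filter fun k : Fin S.card => (k : ℕ) < m,
        c i = J₀ k).card := fun m => by
    rw [Composition.sizeUpTo, ← hsum]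
    exact List.sum_take_ofFn _ _
  have hidx : Fin.cast hlen.symm k = N.index i := by
    rw [← Composition.mem_range_embedding_iff', Composition.mem_range_embedding_iff, hsize, hsize]
    constructor
    · calc _ ≤ (Finset.Iio i).card := Finset.card_le_card fun i' hi' => by
            obtain ⟨-, k', hk', h⟩ := Finset.mem_filter.1 hi'
            have hlt : c i' < c i := by
              rw [h, ← hk]
              exact J₀.strictMono (Finset.mem_filter.1 hk').2
            exact Finset.mem_Iio.2 (hc.reflect_lt hlt)
        _ = i := Fin.card_Iio i
    · calc (i : ℕ) < (Finset.Iic i).card := by rw [Fin.card_Iic]; exact Nat.lt_succ_self _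
        _ ≤ _ := Finset.card_le_card fun i' hi' => by
            obtain ⟨k', hk'⟩ := hmem i'
            refine Finset.mem_filter.2 ⟨Finset.mem_univ _, k', Finset.mem_filter.2
              ⟨Finset.mem_univ _, Nat.lt_succ_of_le ?_⟩, hk'.symm⟩
            have hle := hc (Finset.mem_Iic.1 hi')
            rw [← hk, ← hk'] at hle
            exact J₀.le_iff_le.1 hle
  rw [← hidx, ← hk]
  rfl

end Composition

/-! ### Links of tabulated lists -/

/-- The entry preceding position `i` of a tabulated list. -/
def previous {E : Type*} {m : ℕ} (p : Option E) (g : Fin m → E) (i : Fin m) : Option E :=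
  if (i : ℕ) = 0 then p else some (g ⟨i - 1, by omega⟩)

theorem linkProd_ofFn {E : Type*} (ψ : Option E → E → ℝ) {m : ℕ} (p : Option E) (g : Fin m → E) :
    linkProd ψ p (List.ofFn g) = ∏ i, ψ (previous p g i) (g i) := by
  induction m generalizing p with
  | zero => simp [linkProd]
  | succ m ih =>
    rw [List.ofFn_succ, linkProd, ih, Fin.prod_univ_succ]
    refine congrArg₂ (· * ·) rfl (Finset.prod_congr rfl fun i _ => ?_)
    have h : previous (some (g 0)) (fun i => g i.succ) i = previous p g i.succ := by
      rw [previous, previous, if_neg (show ¬(i.succ : ℕ) = 0 from Nat.succ_ne_zero _)]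
      split_ifs with h
      · congr 2
        exact Fin.ext (by simp [h])
      · congr 2
        exact Fin.ext (by simp only [Fin.succ_mk, Fin.val_succ]; omega)
    rw [h]

theorem chain_eq_linkProd (l : List ℝ) :
    chain l = linkProd (fun p c => 1 / (c - p.getD 0)) none l := by
  have key : ∀ (l : List ℝ) (p : Option ℝ), 1 / chainDenom (p.getD 0) l =
      linkProd (fun p c => 1 / (c - p.getD 0)) p l := by
    intro l
    induction l with
    | nil => intro p; simp [chainDenom, linkProd]
    | cons a l ih =>
      intro p
      rw [chainDenom, linkProd, ← ih (some a), one_div_mul_one_div]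
      rfl
  exact key l none

theorem linkProd_linkX (D : List Entry) : linkProd linkX none D = chain (D.map Entry.x) := by
  have key : ∀ (D : List Entry) (p : Option Entry), linkProd linkX p D =
      linkProd (fun p c => 1 / (c - p.getD 0)) (p.map Entry.x) (D.map Entry.x) := by
    intro D
    induction D with
    | nil => intro p; rfl
    | cons a D ih =>
      intro p
      rw [linkProd, ih, List.map_cons, linkProd]
      cases p <;> rfl
  rw [key, chain_eq_linkProd]
  rfl

/-! ### The terms of the ladder form -/

/-- The labels of a cell: the loops in the order `π`, with interval indices `c`. -/
def labels {L : ℕ} (π : Equiv.Perm (Fin L)) (c : Fin L → ℕ) : List (Fin L × ℕ) :=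
  List.ofFn fun i => (π i, c i)

theorem sideForm_succ_tWall_ne (hZ : IsMHVData n Z) (hn : 4 ≤ n) {j : ℕ} (hj : 3 ≤ j)
    (hjn : j + 1 ≤ n) : sideForm n Z (j + 1) (tWall n Z j) ≠ 0 := by
  refine ((sideForm_succ_pos_iff hZ hn hj hjn _).2 fun h hh => ?_).ne'
  rw [upperWall] at hh
  split_ifs at hh with hlt
  · obtain rfl : tWall n Z (j + 1) = h := by simpa using hh
    exact tWall_lt hZ hn hj (Nat.lt_succ_self j) hlt
  · simp at hh

theorem wVar_cut (s t : ℝ) {x : ℝ} (hx : x ≠ 0) (j : ℕ) :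
    wVar Z (pointA Z x) (pointB n Z s t) j = -sideForm n Z j t / sideForm n Z (j + 1) t := by
  rw [wVar, bracket_cut_one, bracket_cut_one, ← mul_neg, mul_div_mul_left _ _ hx]

/-- Differences of the fractional linear coordinate `w` are proportional to differences of `t`, up
to one factor for each endpoint; the numerator is the determinant of the transformation, evaluated
by Plücker. -/
theorem sideForm_ratio_sub {j : ℕ} {t t' : ℝ} (h : sideForm n Z (j + 1) t ≠ 0)
    (h' : sideForm n Z (j + 1) t' ≠ 0) :
    -sideForm n Z j t / sideForm n Z (j + 1) t - -sideForm n Z j t' / sideForm n Z (j + 1) t' =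
      twoBracket Z j (j + 1) * twoBracket Z 3 n * (t - t') /
        (sideForm n Z (j + 1) t * sideForm n Z (j + 1) t') := by
  rw [div_sub_div _ _ h h']
  congr 1
  have := twoBracket_pluecker Z 3 j (j + 1) n
  simp only [sideForm]
  linear_combination (t' - t) * this

/-- The measure of one loop in a term of the ladder form. -/
theorem kermitFactor_mul (hZ : IsMHVData n Z) (hn : 4 ≤ n) {j : ℕ} (hj : 3 ≤ j) (hjn : j + 1 ≤ n)
    {s t x lo : ℝ} (hx : x ≠ 0) (hs : s ≠ sWall n Z j t x) (ht : t ≠ lo)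
    (h : sideForm n Z (j + 1) t ≠ 0) (h' : sideForm n Z (j + 1) lo ≠ 0) :
    -1 * kermitFactor Z (pointA Z x) (pointB n Z s t) j *
        bracket (pointA Z x) (pointB n Z s t) (-Z 1) (Z n) *
        (1 / (wVar Z (pointA Z x) (pointB n Z s t) j -
          -sideForm n Z j lo / sideForm n Z (j + 1) lo)) =
      1 / (s - sWall n Z j t x) *
        (sideForm n Z (j + 1) lo / (sideForm n Z (j + 1) t * (t - lo))) := by
  have hg := (hZ.twoBracket_pos hn hj (Nat.lt_succ_self j) hjn).ne'
  have hb := (hZ.twoBracket_pos hn le_rfl (show 3 < n by omega) le_rfl).ne'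
  have hs' := sub_ne_zero.2 hs
  have ht' := sub_ne_zero.2 ht
  rw [wVar_cut _ _ hx, sideForm_ratio_sub h h', kermitFactor, bracket_cut_one_edge,
    bracket_cut_one, bracket_cut_edge _ _ hx hg, bracket_neg_third, bracket_cut_one, sideForm_last]
  field_simp

/-- After distributing one sign `-1` to each loop and splitting products over the blocks, the
identity holds loop by loop. It is `kermitFactor_mul` with `lo` the lower end for `t`. -/
theorem ladder_term_eq (hZ : IsMHVData n Z) (hn : 4 ≤ n) {L : ℕ} {u : Fin (3 * L) → ℝ}
    (hu : InGeneralPosition n Z u) (N : Composition L) (J : Fin N.length → ℕ) (hJ : StrictMono J)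
    (hJn : ∀ k, 3 ≤ J k ∧ J k + 1 ≤ n) (π : Equiv.Perm (Fin L)) :
    (-1) ^ L * (chain (List.ofFn fun a => xCoord u (π a)).reverse *
      ∏ k : Fin N.length,
        ((∏ a : Fin (N.blocksFun k),
            kermitFactor Z (pointA Z (xCoord u (π (N.embedding k a))))
              (pointB n Z (sCoord u (π (N.embedding k a))) (tCoord u (π (N.embedding k a))))
              (J k)) *
          chain (List.ofFn fun a : Fin (N.blocksFun k) =>
            wVar Z (pointA Z (xCoord u (π (N.embedding k a))))
              (pointB n Z (sCoord u (π (N.embedding k a))) (tCoord u (π (N.embedding k a))))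
              (J k)))) *
      ∏ α, bracket (pointA Z (xCoord u α)) (pointB n Z (sCoord u α) (tCoord u α)) (-Z 1) (Z n) =
    cellForm n Z ((labels π fun i => J (N.index i)).map (entry u)) := by
  set g : Fin L → Entry := fun i => entry u (π i, J (N.index i)) with hg
  have hD : (labels π fun i => J (N.index i)).map (entry u) = List.ofFn g := by
    rw [labels, List.map_ofFn]; rfl
  have hblock : ∀ f : Fin L → ℝ, ∏ i, f i = ∏ k, ∏ a, f (N.embedding k a) := by
    intro f
    rw [← N.blocksFinEquiv.prod_comp f, Fintype.prod_sigma]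
    rfl
  rw [hD, cellForm, linkProd_linkX, List.map_reverse, List.map_ofFn, List.map_ofFn, List.prod_ofFn,
    linkProd_ofFn, mul_assoc, mul_comm (_ : ℝ) (chain _), mul_assoc, mul_assoc]
  rw [mul_left_comm]
  refine congrArg₂ (· * ·) rfl ?_
  rw [← Equiv.prod_comp π, ← Finset.prod_mul_distrib, hblock, hblock,
    show (-1 : ℝ) ^ L = ∏ _i : Fin L, (-1 : ℝ) by simp, hblock]
  simp only [← Finset.prod_mul_distrib, Function.comp_apply]
  refine Finset.prod_congr rfl fun k _ => ?_
  rw [chain_eq_linkProd, linkProd_ofFn]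
  simp only [← Finset.prod_mul_distrib]
  refine Finset.prod_congr rfl fun a _ => ?_
  -- Within a block the predecessor has the same interval index and supplies the lower end. The
  -- first entry of a block is preceded by nothing or by another index, since `J` is injective, so
  -- its lower end is the wall.
  have hlow : lowerT n Z (previous none g (N.embedding k a)) (J k) =
      if (a : ℕ) = 0 then tWall n Z (J k) else
        tCoord u (π (N.embedding k ⟨a - 1, by omega⟩)) := by
    rw [previous]
    split_ifs with h1 h2 h2
    · rfl
    · rw [Composition.coe_embedding] at h1
      omega
    · have hne : N.index ⟨(N.embedding k a : ℕ) - 1, by omega⟩ ≠ k := by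
        intro h
        have := N.sizeUpTo_index_le ⟨(N.embedding k a : ℕ) - 1, by omega⟩
        rw [h] at this
        simp only [Composition.coe_embedding] at this h1
        omega
      have hne' : (g ⟨(N.embedding k a : ℕ) - 1, by omega⟩).j ≠ J k :=
        fun h => hne (hJ.injective h)
      simp only [lowerT, Option.elim]
      rw [if_neg hne']
    · have he : (⟨(N.embedding k a : ℕ) - 1, by omega⟩ : Fin L) =
          N.embedding k ⟨a - 1, by omega⟩ := by
        apply Fin.ext
        simp only [Composition.coe_embedding]
        omega
      have hj : (g (N.embedding k ⟨a - 1, by omega⟩)).j = J k :=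
        congrArg J (N.index_embedding _ _)
      rw [he]
      simp only [lowerT, Option.elim]
      rw [if_pos hj]
      rfl
  obtain ⟨hj, hjn⟩ := hJn k
  -- The initial `0` of each chain is the value of `w` at the left wall of the interval.
  have hw : (previous none (fun a : Fin (N.blocksFun k) =>
      wVar Z (pointA Z (xCoord u (π (N.embedding k a))))
        (pointB n Z (sCoord u (π (N.embedding k a))) (tCoord u (π (N.embedding k a))))
        (J k)) a).getD 0 =
      -sideForm n Z (J k) (lowerT n Z (previous none g (N.embedding k a)) (J k)) /
        sideForm n Z (J k + 1) (lowerT n Z (previous none g (N.embedding k a)) (J k)) := by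
    rw [hlow, previous]
    split_ifs with h
    · rw [sideForm_tWall hZ hn hj hjn, neg_zero, zero_div]
      rfl
    · exact wVar_cut _ _ (hu.x_ne _) _
  have hne : tCoord u (π (N.embedding k a)) ≠
      lowerT n Z (previous none g (N.embedding k a)) (J k) := by
    rw [hlow]
    split_ifs with h
    · exact fun h' => hu.side_ne _ (J k) hj (by omega) (h' ▸ sideForm_tWall hZ hn hj hjn)
    · refine hu.t_ne_t _ _ fun h' => ?_
      have h2 := congrArg Fin.val ((N.embedding k).injective (π.injective h'))
      simp only at h2
      omega
  have hne' : sideForm n Z (J k + 1) (lowerT n Z (previous none g (N.embedding k a)) (J k)) ≠ 0 := by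
    rw [hlow]
    split_ifs with h
    · exact sideForm_succ_tWall_ne hZ hn hj hjn
    · exact hu.side_ne _ _ (by omega) hjn
  have key := kermitFactor_mul hZ hn hj hjn (hu.x_ne (π (N.embedding k a)))
    (hu.s_ne (π (N.embedding k a)) (J k) hj hjn) hne
    (hu.side_ne (π (N.embedding k a)) (J k + 1) (by omega) hjn) hne'
  have hgj : (g (N.embedding k a)).j = J k := congrArg J (N.index_embedding _ _)
  rw [hw, linkT, hgj]
  refine Eq.trans ?_ key
  ring

theorem indexSets_iff {m : ℕ} (J : Fin m → ℕ) :
    J ∈ indexSets n m ↔ (∀ k, 3 ≤ J k ∧ J k + 1 ≤ n) ∧ StrictMono J := by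
  rw [indexSets, Finset.mem_filter, Fintype.mem_piFinset]
  simp only [Finset.mem_Ico]
  rfl

theorem ladderCoeff_eq (hZ : IsMHVData n Z) (hn : 4 ≤ n) {L : ℕ} {u : Fin (3 * L) → ℝ}
    (hu : InGeneralPosition n Z u) :
    ladderCoeff n Z L u = ∑ N : Composition L, ∑ J ∈ indexSets n N.length,
      ∑ π : Equiv.Perm (Fin L), cellForm n Z ((labels π fun i => J (N.index i)).map (entry u)) := by
  rw [ladderCoeff, ladderForm]
  simp only [Finset.mul_sum, Finset.sum_mul]
  refine Finset.sum_congr rfl fun N _ => Finset.sum_congr rfl fun J hJ =>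
    Finset.sum_congr rfl fun π _ => ?_
  rw [indexSets_iff] at hJ
  exact ladder_term_eq hZ hn hu N J hJ.2 hJ.1 π

/-! ### Decomposition of the ladder region into cells -/

theorem inCell_labels_iff {L : ℕ} (u : Fin (3 * L) → ℝ) (π : Equiv.Perm (Fin L)) (c : Fin L → ℕ) :
    InCell n Z ((labels π c).map (entry u)) ↔
      (∀ a b, a < b → tCoord u (π a) < tCoord u (π b) ∧ xCoord u (π b) < xCoord u (π a)) ∧
      ∀ a, 0 < xCoord u (π a) ∧ sideForm n Z (c a) (tCoord u (π a)) < 0 ∧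
        0 < sideForm n Z (c a + 1) (tCoord u (π a)) ∧
        sWall n Z (c a) (tCoord u (π a)) (xCoord u (π a)) < sCoord u (π a) := by
  rw [InCell, labels, List.map_ofFn, List.pairwise_ofFn, List.forall_mem_ofFn_iff]
  rfl

theorem interval_mono (hZ : IsMHVData n Z) (hn : 4 ≤ n) {j j' : ℕ} {t t' : ℝ}
    (hjn : j + 1 ≤ n) (hj' : 3 ≤ j') (h : sideForm n Z j t < 0)
    (h' : 0 < sideForm n Z (j' + 1) t') (htt : t ≤ t') : j ≤ j' := by
  by_contra! hlt
  rw [sideForm_neg_iff hZ hn (by omega) hjn] at h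
  rw [sideForm_pos_iff hZ hn (by omega) (by omega)] at h'
  linarith [tWall_le hZ hn (show 3 ≤ j' + 1 by omega) hlt hjn]

theorem sideForm_neg_of_le (hZ : IsMHVData n Z) (hn : 4 ≤ n) {j k : ℕ} {t : ℝ}
    (hjn : j + 1 ≤ n) (h : sideForm n Z j t < 0) (hk : 3 ≤ k) (hkj : k ≤ j) :
    sideForm n Z k t < 0 := by
  rw [sideForm_neg_iff hZ hn (by omega) (by omega)] at h ⊢
  exact (tWall_le hZ hn hk hkj hjn).trans_lt h

theorem sideForm_pos_of_lt (hZ : IsMHVData n Z) (hn : 4 ≤ n) {j k : ℕ} {t : ℝ}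
    (hj : 3 ≤ j) (h : 0 < sideForm n Z (j + 1) t) (hjk : j < k) (hkn : k ≤ n) :
    0 < sideForm n Z k t := by
  rcases hkn.eq_or_lt with rfl | hkn
  · rw [sideForm_last]
    exact hZ.twoBracket_pos hn le_rfl (by omega) le_rfl
  · rw [sideForm_pos_iff hZ hn (by omega) (by omega)] at h ⊢
    exact h.trans_le (tWall_le hZ hn (by omega) hjk hkn)

/-- A discrete intermediate value argument: the side form is negative at `3` because `t > 0`, and
positive at `n`. -/
theorem exists_interval (hZ : IsMHVData n Z) (hn : 4 ≤ n) {t : ℝ} (ht : 0 < t)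
    (hne : ∀ i, 3 ≤ i → i ≤ n → sideForm n Z i t ≠ 0) :
    ∃ j, (3 ≤ j ∧ j + 1 ≤ n) ∧ sideForm n Z j t < 0 ∧ 0 < sideForm n Z (j + 1) t := by
  have hb := hZ.twoBracket_pos hn le_rfl (show 3 < n by omega) le_rfl
  have h3 : sideForm n Z 3 t < 0 := by
    rw [sideForm_three]
    exact neg_neg_of_pos (mul_pos ht hb)
  by_contra! hcon
  have key : ∀ k, 3 ≤ k → k ≤ n → sideForm n Z k t < 0 := by
    intro k hk
    induction k, hk using Nat.le_induction with
    | base => exact fun _ => h3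
    | succ k hk ih =>
      intro hkn
      exact (hcon k ⟨hk, hkn⟩ (ih (by omega))).lt_of_ne (hne _ (by omega) hkn)
  have := key n (by omega) le_rfl
  rw [sideForm_last] at this
  exact this.not_gt hb

section Decomposition

variable {L : ℕ} {u : Fin (3 * L) → ℝ} {π π' : Equiv.Perm (Fin L)} {c c' : Fin L → ℕ}

/-- A cell imposes only the wall of its own edge on `σ`; by `sWall_le` this implies the conditions
of all the other edges. -/
theorem mem_ladderRegion_of_inCell (hZ : IsMHVData n Z) (hn : 4 ≤ n)
    (hc : ∀ a, 3 ≤ c a ∧ c a + 1 ≤ n) (h : InCell n Z ((labels π c).map (entry u))) :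
    u ∈ ladderRegion n Z L := by
  rw [inCell_labels_iff] at h
  obtain ⟨h1, h2⟩ := h
  have h2' : ∀ α, 0 < xCoord u α ∧ sideForm n Z (c (π.symm α)) (tCoord u α) < 0 ∧
      0 < sideForm n Z (c (π.symm α) + 1) (tCoord u α) ∧
      sWall n Z (c (π.symm α)) (tCoord u α) (xCoord u α) < sCoord u α := fun α => by
    simpa using h2 (π.symm α)
  have hneg := fun α k => sideForm_neg_of_le (k := k) hZ hn (hc (π.symm α)).2 (h2' α).2.1
  have hpos := fun α k => sideForm_pos_of_lt (k := k) hZ hn (hc (π.symm α)).1 (h2' α).2.2.1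
  refine mem_ladderRegion_of hZ hn (fun α => c (π.symm α)) (fun α => hc _) hneg hpos
    (fun α => (h2' α).1) (fun α => ?_) (fun α i hi hin => ?_) fun α β hαβ => ?_
  · have := hneg α 3 le_rfl (hc _).1
    rw [sideForm_three, neg_lt_zero] at this
    exact pos_of_mul_pos_left this
      (hZ.twoBracket_pos hn le_rfl (show 3 < n by omega) le_rfl).le
  · exact (sWall_le hZ hn (h2' α).1 hi hin (hc _).1 (hc _).2 (hneg α) (hpos α)).trans_lt
      (h2' α).2.2.2
  · have hord : ∀ α β, π.symm α < π.symm β →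
        tCoord u α < tCoord u β ∧ xCoord u β < xCoord u α := fun α β h => by
      simpa using h1 _ _ h
    rcases lt_trichotomy (π.symm α) (π.symm β) with h | h | h
    · obtain ⟨h3, h4⟩ := hord α β h
      exact mul_pos (sub_pos.2 h4) (sub_pos.2 h3)
    · exact absurd (π.symm.injective h) hαβ.ne
    · obtain ⟨h3, h4⟩ := hord β α h
      exact mul_pos_of_neg_of_neg (sub_neg.2 h4) (sub_neg.2 h3)

/-- Both permutations list the distinct values of `t` in increasing order, and each `t` lies in only
one interval, so the cells are disjoint. -/
theorem inCell_unique (hZ : IsMHVData n Z) (hn : 4 ≤ n)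
    (hc : ∀ a, 3 ≤ c a ∧ c a + 1 ≤ n) (hc' : ∀ a, 3 ≤ c' a ∧ c' a + 1 ≤ n)
    (h : InCell n Z ((labels π c).map (entry u))) (h' : InCell n Z ((labels π' c').map (entry u))) :
    π = π' ∧ c = c' := by
  rw [inCell_labels_iff] at h h'
  have hm : StrictMono (tCoord u ∘ π) := fun a b hab => (h.1 a b hab).1
  have hm' : StrictMono (tCoord u ∘ π') := fun a b hab => (h'.1 a b hab).1
  have hinj : Function.Injective (tCoord u) := by
    intro α β hαβ
    have := hm.injective (a₁ := π.symm α) (a₂ := π.symm β) (by simpa using hαβ)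
    exact π.symm.injective this
  have heq : tCoord u ∘ π = tCoord u ∘ π' := by
    refine (hm.range_inj hm').1 ?_
    rw [Set.range_comp, Set.range_comp, π.surjective.range_eq, π'.surjective.range_eq]
  have hπ : π = π' := Equiv.ext fun a => hinj (congrFun heq a)
  subst hπ
  refine ⟨rfl, funext fun a => le_antisymm ?_ ?_⟩
  · exact interval_mono hZ hn (hc a).2 (hc' a).1 (h.2 a).2.1 (h'.2 a).2.2.1 le_rfl
  · exact interval_mono hZ hn (hc' a).2 (hc a).1 (h'.2 a).2.1 (h.2 a).2.2.1 le_rfl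

/-- The permutation sorts the loops by `t`. Mutual positivity then makes `x` decrease, and larger
`t` lies in the same or a later interval, so the indices are monotone. -/
theorem exists_inCell (hZ : IsMHVData n Z) (hn : 4 ≤ n) (hu : InGeneralPosition n Z u)
    (h : u ∈ ladderRegion n Z L) :
    ∃ (π : Equiv.Perm (Fin L)) (c : Fin L → ℕ), Monotone c ∧ (∀ a, 3 ≤ c a ∧ c a + 1 ≤ n) ∧
      InCell n Z ((labels π c).map (entry u)) := by
  obtain ⟨h1, h2⟩ := mem_ladderRegion_imp hZ hn hu.x_ne (hu.t_ne hn) hu.s_ne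
    (fun α β hαβ => hu.x_ne_x _ _ hαβ.ne) (fun α β hαβ => hu.t_ne_t _ _ hαβ.ne) h
  choose j hj using fun α => exists_interval hZ hn (h1 α).2.1 (hu.side_ne α)
  set π := Tuple.sort (tCoord u) with hπ
  have hmono : Monotone (tCoord u ∘ π) := Tuple.monotone_sort _
  have ht : ∀ a b, a < b → tCoord u (π a) < tCoord u (π b) := fun a b hab =>
    (hmono hab.le).lt_of_ne (hu.t_ne_t _ _ fun h => hab.ne (π.injective h))
  have hx : ∀ α β, tCoord u α < tCoord u β → xCoord u β < xCoord u α := by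
    intro α β hαβ
    rcases lt_trichotomy α β with h | rfl | h
    · exact sub_pos.1 (pos_of_mul_pos_left (h2 α β h) (sub_pos.2 hαβ).le)
    · exact absurd hαβ (lt_irrefl _)
    · exact sub_neg.1 (neg_of_mul_pos_left (h2 β α h) (sub_neg.2 hαβ).le)
  refine ⟨π, fun a => j (π a), fun a b hab => ?_, fun a => (hj _).1, ?_⟩
  · exact interval_mono hZ hn (hj _).1.2 (hj _).1.1 (hj _).2.1 (hj _).2.2 (hmono hab)
  · rw [inCell_labels_iff]
    exact ⟨fun a b hab => ⟨ht a b hab, hx _ _ (ht a b hab)⟩, fun a => ⟨(h1 _).1, (hj _).2.1,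
      (hj _).2.2, (h1 _).2.2 _ (hj _).1.1 (hj _).1.2⟩⟩

open Classical in
theorem indicator_eq_sum_cells (hZ : IsMHVData n Z) (hn : 4 ≤ n) (hu : InGeneralPosition n Z u) :
    (ladderRegion n Z L).indicator (1 : (Fin (3 * L) → ℝ) → ℤ) u =
      ∑ N : Composition L, ∑ J ∈ indexSets n N.length, ∑ π : Equiv.Perm (Fin L),
        if InCell n Z ((labels π fun i => J (N.index i)).map (entry u)) then 1 else 0 := by
  by_cases h : u ∈ ladderRegion n Z L
  · obtain ⟨π, c, hmono, hc, hcell⟩ := exists_inCell hZ hn hu h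
    obtain ⟨N, J, hJ, hJc⟩ := exists_composition hmono
    obtain rfl : (fun i => J (N.index i)) = c := funext hJc
    have hJmem : J ∈ indexSets n N.length := (indexSets_iff J).2 ⟨fun k => by
      obtain ⟨i, rfl⟩ := index_surjective N k
      exact hc i, hJ⟩
    have huniq : ∀ (N' : Composition L) (J' : Fin N'.length → ℕ) (π' : Equiv.Perm (Fin L)),
        J' ∈ indexSets n N'.length →
        InCell n Z ((labels π' fun i => J' (N'.index i)).map (entry u)) →
        π = π' ∧ (fun i => J (N.index i)) = fun i => J' (N'.index i) := fun N' J' π' hJ' h' =>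
      inCell_unique hZ hn hc (fun a => ((indexSets_iff J').1 hJ').1 _) hcell h'
    -- Exactly one summand survives: cells are disjoint, and a composition with increasing `J` is
    -- determined by the index map.
    rw [Set.indicator_of_mem h, Finset.sum_eq_single N, Finset.sum_eq_single J,
      Finset.sum_eq_single π, if_pos hcell]
    · rfl
    · exact fun π' _ hne => if_neg fun h' => hne (huniq N J π' hJmem h').1.symm
    · exact fun h' => absurd (Finset.mem_univ _) h'
    · refine fun J' hJ' hne => Finset.sum_eq_zero fun π' _ => if_neg fun h' => hne (funext fun k => ?_)
      obtain ⟨i, rfl⟩ := index_surjective N k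
      exact (congrFun (huniq N J' π' hJ' h').2 i).symm
    · exact fun h' => absurd hJmem h'
    · refine fun N' _ hne => Finset.sum_eq_zero fun J' hJ' => Finset.sum_eq_zero fun π' _ =>
        if_neg fun h' => hne ?_
      exact (composition_unique hJ ((indexSets_iff J').1 hJ').2
        (congrFun (huniq N' J' π' hJ' h').2)).symm
    · exact fun h' => absurd (Finset.mem_univ _) h'
  · rw [Set.indicator_of_notMem h]
    refine (Finset.sum_eq_zero fun N _ => Finset.sum_eq_zero fun J hJ =>
      Finset.sum_eq_zero fun π _ => if_neg fun h' => h ?_).symm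
    exact mem_ladderRegion_of_inCell hZ hn (fun a => ((indexSets_iff J).1 hJ).1 _) h'

end Decomposition

/-- Generically the indicator is the sum of the cell weights and the ladder coefficient is the sum
of the cell forms over the same labels, so additivity of canonical forms concludes. -/
theorem isCanonicalForm_ladder (hZ : IsMHVData n Z) (hn : 4 ≤ n) (L : ℕ) :
    IsCanonicalForm (3 * L) ((ladderRegion n Z L).indicator 1) (ladderCoeff n Z L) := by
  classical
  have hgen := generic_inGeneralPosition hZ hn L
  refine (IsCanonicalForm.sum Finset.univ fun N _ => IsCanonicalForm.sum (indexSets n N.length)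
    fun J hJ => IsCanonicalForm.sum Finset.univ fun π _ => isCanonicalForm_cell hZ hn L
      (labels π fun i => J (N.index i)) ?_ ?_ ?_ ?_).congr
    (hgen.mono fun u hu => ?_) (hgen.mono fun u hu => ladderCoeff_eq hZ hn hu)
  · rw [labels, List.map_ofFn]
    exact List.nodup_ofFn.2 π.injective
  · exact List.length_ofFn
  · rw [labels, List.pairwise_ofFn]
    exact fun a b hab => ((indexSets_iff J).1 hJ).2.monotone (monotone_index N hab.le)
  · rw [labels, List.forall_mem_ofFn_iff]
    exact fun a => ((indexSets_iff J).1 hJ).1 _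
  · rw [indicator_eq_sum_cells hZ hn hu]

end LadderCut

end

theorem mainTheorem5 (n : ℕ) (hn : 4 ≤ n) (Z : ℕ → LadderCut.Twistor)
    (hZ : LadderCut.IsMHVData n Z) (L : ℕ) :
    LadderCut.IsCanonicalForm (3 * L) ((LadderCut.ladderRegion n Z L).indicator 1)
        (LadderCut.ladderCoeff n Z L) ∧
      ∀ Ω : (Fin (3 * L) → ℝ) → ℝ,
        LadderCut.IsCanonicalForm (3 * L) ((LadderCut.ladderRegion n Z L).indicator 1) Ω →
          LadderCut.Generic fun u => Ω u = LadderCut.ladderCoeff n Z L u :=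
  ⟨LadderCut.isCanonicalForm_ladder hZ hn L, fun _ hΩ =>
    hΩ.generic_unique (LadderCut.isCanonicalForm_ladder hZ hn L)⟩
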